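/- Let $\Gamma$ be a divisible totally ordered abelian group (possibly trivial), written additively. Let $\mathbb{T}_{\max}=(\Gamma\cup\{\bot\},\max,+)$ be the tropical semifield over $\Gamma$, with zero $\mathbb{0}=\bot$ and unit $\mathbb{1}=0$. Let $\mathbb{S}_{\max}$ be the symmetrized tropical semiring: the quotient of $\mathbb{T}_{\max}^2$, with operations $(a_1,a_2)\oplus(b_1,b_2)=(a_1\oplus b_1,a_2\oplus b_2)$ and $(a_1,a_2)\odot(b_1,b_2)=(a_1b_1\oplus a_2b_2,\;a_1b_2\oplus a_2b_1)$, by the congruence which identifies $(a_1,a_2)$ and $(b_1,b_2)$ if they are equal, or if $a_1\ne a_2$, $b_1\neq b_2$ and $a_1\oplus b_2=a_2\oplus b_1$. It carries the maps $\ominus\overline{(a_1,a_2)}=\overline{(a_2,a_1)}$ and $|\overline{(a_1,a_2)}|=a_1\oplus a_2\in\mathbb{T}_{\max}$, and the balance relation $\overline{(a_1,a_2)}\,\nabla\,\overline{(b_1,b_2)}\iff a_1\oplus b_2=a_2\oplus b_1$. Identify $c\in\mathbb{T}_{\max}$ with $\overline{(c,\bot)}$; let $\mathbb{S}_{\max}^{\oplus}$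 be the set of these elements, $\mathbb{S}_{\max}^{\ominus}=\{\ominus a: a\in \mathbb{S}_{\max}^{\oplus}\}$, and let $\mathbb{S}_{\max}^\vee=\mathbb{S}_{\max}^{\oplus}\cup\mathbb{S}_{\max}^{\ominus}$ be the set of signed elements. For a formal polynomial $P=\bigoplus_k P_k\mathsf{Y}^k$ write $\widehat P$ for its polynomial function, and $|P|=\bigoplus_k|P_k|\mathsf{Y}^k$. For $P\in\mathbb{S}_{\max}^\vee[\mathsf{Y}]$ (all coefficients signed), a signed $a$ is a root of $P$ if $\widehat P(a)\,\nabla\,\mathbb{0}$. The multiplicity $\mathrm{mult}_a(P)$ is $0$ if $a$ is not a root of $P$, and otherwise $$\mathrm{mult}_a(P)=1+\max\{\mathrm{mult}_a(Q) : Q\in\mathbb{S}_{\max}^\vee[\mathsf{Y}],\ \lambda P\,\nabla\,(\mathsf{Y}\ominus a)Q \text{ coefficientwise for some } \lambda\in\mathbb{S}_{\max}^\vee\setminus\{\mathbb{0}\}\}.$$ $P$ has $n$ roots counted with multiplicity if there are $r_1,\dots,r_n\in\mathbb{S}_{\max}^\vee$ such that every $a\in\mathbb{S}_{\max}^\vee$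 occurs exactly $\mathrm{mult}_a(P)$ times among them. A non-zero corner of $|P|$ is a $c\in\Gamma$ at which the maximum $\widehat{|P|}(c)=\bigoplus_k|P_k|\odot c^{\odot k}$ is attained by at least two different monomials of $|P|$. For such $c$ let $\mathrm{sat}(c,P)=\{i\in\{0,\dots,\deg P\} : |\widehat P(c)|=|P_i|\odot c^{\odot i}\}$ and $$P^{\mathrm{sat},c}=\bigoplus_{i\in\mathrm{sat}(c,P)}|\widehat P(c)|^{\odot-1}\odot c^{\odot i}\odot P_i\,\mathsf{Y}^i .$$ Call $k<\ell$ successive degrees of a polynomial $Q$ if $Q_k\neq\mathbb{0}$, $Q_\ell\ne\mathbb{0}$, and $Q_i=\mathbb{0}$ for $k<i<\ell$. **Theorem.** Let $P\in\mathbb{S}_{\max}^\vee[\mathsf{Y}]$ have degree $n$ (so $P\neq \mathbb{0}$). Then $P$ has $n$ roots counted with multiplicity if and only if, for all non-zero corners $c$ of $|P|$ and all successive degrees $k<\ell$ of $P^{\mathrm{sat},c}$, either $\ell-k=1$, or $\ell-k=2$ and $P^{\mathrm{sat},c}_\ell=\ominus P^{\mathrm{sat},c}_k$. Moreover, for all such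 $c$, $k$ and $\ell$, the condition $P^{\mathrm{sat},c}_\ell=\ominus P^{\mathrm{sat},c}_k$ is equivalent to $P_\ell\odot P_k\in\mathbb{S}_{\max}^{\ominus}$. -/

import Mathlib

set_option linter.unusedSectionVars false

noncomputable section

/-! ### The tropical semifield -/

/-- The tropical semifield `T_max(Γ) = (Γ ∪ {⊥}, max, +)` over an ordered abelian group `Γ`.
The underlying ordered set is `Γ` with a bottom element adjoined.  It is written multiplicatively:
`*` is the addition of `Γ`, `1` is the zero of `Γ`, `0` is the bottom element `⊥`, and `+` is
the maximum. -/
def Tmax (Γ : Type*) : Type _ := WithZero (Multiplicative Γ)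

namespace Tmax

variable {Γ : Type*} [AddCommGroup Γ] [LinearOrder Γ] [IsOrderedAddMonoid Γ]

instance : LinearOrderedCommGroupWithZero (Tmax Γ) :=
  inferInstanceAs (LinearOrderedCommGroupWithZero (WithZero (Multiplicative Γ)))

instance : Add (Tmax Γ) := ⟨max⟩

instance : CommSemiring (Tmax Γ) where
  add_assoc := max_assoc
  add_comm := max_comm
  zero_add a := max_eq_right (zero_le (a := a))
  add_zero a := max_eq_left (zero_le (a := a))
  nsmul := nsmulRec
  left_distrib a b c := Monotone.map_max (f := fun x => a * x) fun _ _ h => mul_le_mul_right h a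
  right_distrib a b c := Monotone.map_max (f := fun x => x * c) fun _ _ h => mul_le_mul_left h c
  zero_mul := zero_mul
  mul_zero := mul_zero
  mul_assoc := mul_assoc
  one_mul := one_mul
  mul_one := mul_one
  mul_comm := mul_comm
  npow n a := a ^ n
  npow_zero := pow_zero
  npow_succ n a := pow_succ a n

theorem add_eq_max (a b : Tmax Γ) : a + b = max a b := rfl

end Tmax

/-! ### Pairs of tropical numbers -/

/-- The semiring `T_max × T_max` with the multiplication of formal differences. -/
@[ext] structure TmaxPair (Γ : Type*) where
  fst : Tmax Γ
  snd : Tmax Γ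

namespace TmaxPair

variable {Γ : Type*} [AddCommGroup Γ] [LinearOrder Γ] [IsOrderedAddMonoid Γ]

instance : Zero (TmaxPair Γ) := ⟨⟨0, 0⟩⟩
instance : One (TmaxPair Γ) := ⟨⟨1, 0⟩⟩
instance : Add (TmaxPair Γ) := ⟨fun a b => ⟨a.fst + b.fst, a.snd + b.snd⟩⟩
instance : Mul (TmaxPair Γ) :=
  ⟨fun a b => ⟨a.fst * b.fst + a.snd * b.snd, a.fst * b.snd + a.snd * b.fst⟩⟩

@[simp] theorem zero_fst : (0 : TmaxPair Γ).fst = 0 := rfl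
@[simp] theorem zero_snd : (0 : TmaxPair Γ).snd = 0 := rfl
@[simp] theorem one_fst : (1 : TmaxPair Γ).fst = 1 := rfl
@[simp] theorem one_snd : (1 : TmaxPair Γ).snd = 0 := rfl
@[simp] theorem add_fst (a b : TmaxPair Γ) : (a + b).fst = a.fst + b.fst := rfl
@[simp] theorem add_snd (a b : TmaxPair Γ) : (a + b).snd = a.snd + b.snd := rfl
@[simp] theorem mul_fst (a b : TmaxPair Γ) :
    (a * b).fst = a.fst * b.fst + a.snd * b.snd := rfl
@[simp] theorem mul_snd (a b : TmaxPair Γ) :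
    (a * b).snd = a.fst * b.snd + a.snd * b.fst := rfl

instance : CommSemiring (TmaxPair Γ) where
  add_assoc a b c := by ext <;> simp <;> ring
  zero_add a := by ext <;> simp
  add_zero a := by ext <;> simp
  add_comm a b := by ext <;> simp <;> ring
  nsmul := nsmulRec
  left_distrib a b c := by ext <;> simp <;> ring
  right_distrib a b c := by ext <;> simp <;> ring
  zero_mul a := by ext <;> simp
  mul_zero a := by ext <;> simp
  mul_assoc a b c := by ext <;> simp <;> ring
  one_mul a := by ext <;> simp
  mul_one a := by ext <;> simp
  mul_comm a b := by ext <;> simp <;> ring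

/-- The minus operator `⊖ (a₁, a₂) = (a₂, a₁)`. -/
def neg (a : TmaxPair Γ) : TmaxPair Γ := ⟨a.snd, a.fst⟩

/-- The balance relation on pairs: `a₁ ⊕ b₂ = a₂ ⊕ b₁`. -/
def Balance (a b : TmaxPair Γ) : Prop := a.fst + b.snd = a.snd + b.fst

/-- The relation by which `T_max × T_max` is divided: the balance relation between two pairs
with distinct components, and equality otherwise. -/
def Rel (a b : TmaxPair Γ) : Prop :=
  (a.fst ≠ a.snd ∧ b.fst ≠ b.snd ∧ Balance a b) ∨
    (¬ (a.fst ≠ a.snd ∧ b.fst ≠ b.snd) ∧ a = b)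

theorem rel_iff (a b : TmaxPair Γ) : Rel a b ↔
    (a.snd < a.fst ∧ b.snd < b.fst ∧ a.fst = b.fst) ∨
    (a.fst < a.snd ∧ b.fst < b.snd ∧ a.snd = b.snd) ∨ a = b := by
  obtain ⟨a1, a2⟩ := a
  obtain ⟨b1, b2⟩ := b
  simp only [Rel, Balance, Tmax.add_eq_max, TmaxPair.mk.injEq]
  grind

theorem rel_equivalence : Equivalence (Rel (Γ := Γ)) := by
  refine ⟨fun a => ?_, fun {a b} h => ?_, fun {a b c} h h' => ?_⟩
  · rw [rel_iff]; tauto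
  · rw [rel_iff] at *; grind
  · rw [rel_iff] at *; grind

theorem rel_add_right {a b : TmaxPair Γ} (h : Rel a b) (c : TmaxPair Γ) :
    Rel (a + c) (b + c) := by
  obtain ⟨a1, a2⟩ := a
  obtain ⟨b1, b2⟩ := b
  obtain ⟨c1, c2⟩ := c
  rw [rel_iff] at *
  simp only [add_fst, add_snd, Tmax.add_eq_max, TmaxPair.ext_iff] at *
  grind

theorem rel_mul_right {a b : TmaxPair Γ} (h : Rel a b) (c : TmaxPair Γ) :
    Rel (a * c) (b * c) := by
  obtain ⟨a1, a2⟩ := a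
  obtain ⟨b1, b2⟩ := b
  obtain ⟨c1, c2⟩ := c
  have lt : ∀ {x y z : Tmax Γ}, x < y → z ≠ 0 → x * z < y * z := fun hxy hz =>
    mul_lt_mul_of_pos_right hxy (zero_lt_iff.2 hz)
  have lt' : ∀ {x y z : Tmax Γ}, x < y → z ≠ 0 → z * x < z * y := fun hxy hz =>
    mul_lt_mul_of_pos_left hxy (zero_lt_iff.2 hz)
  have ne : ∀ {x y : Tmax Γ}, x < y → y ≠ 0 := fun hxy => (lt_of_le_of_lt zero_le hxy).ne'
  rw [rel_iff] at *
  simp only [mul_fst, mul_snd, Tmax.add_eq_max, TmaxPair.ext_iff] at *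
  rcases h with ⟨h1, h2, rfl⟩ | ⟨h1, h2, rfl⟩ | ⟨rfl, rfl⟩
  · rcases lt_trichotomy c1 c2 with h | rfl | h
    · have := lt h1 (ne h); have := lt h2 (ne h); have := lt' h (ne h1)
      have := lt_of_le_of_lt (mul_le_mul_right h.le a2) (lt h1 (ne h))
      have := lt_of_le_of_lt (mul_le_mul_right h.le b2) (lt h2 (ne h))
      grind
    · have := mul_le_mul_left h1.le c1; have := mul_le_mul_left h2.le c1
      grind
    · have := lt h1 (ne h); have := lt h2 (ne h); have := lt' h (ne h1)
      have := lt_of_le_of_lt (mul_le_mul_right h.le a2) (lt h1 (ne h))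
      have := lt_of_le_of_lt (mul_le_mul_right h.le b2) (lt h2 (ne h))
      grind
  · rcases lt_trichotomy c1 c2 with h | rfl | h
    · have := lt h1 (ne h); have := lt h2 (ne h); have := lt' h (ne h1)
      have := lt_of_le_of_lt (mul_le_mul_right h.le a1) (lt h1 (ne h))
      have := lt_of_le_of_lt (mul_le_mul_right h.le b1) (lt h2 (ne h))
      grind
    · have := mul_le_mul_left h1.le c1; have := mul_le_mul_left h2.le c1
      grind
    · have := lt h1 (ne h); have := lt h2 (ne h); have := lt' h (ne h1)
      have := lt_of_le_of_lt (mul_le_mul_right h.le a1) (lt h1 (ne h))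
      have := lt_of_le_of_lt (mul_le_mul_right h.le b1) (lt h2 (ne h))
      grind
  · simp

theorem rel_neg {a b : TmaxPair Γ} (h : Rel a b) : Rel a.neg b.neg := by
  obtain ⟨a1, a2⟩ := a
  obtain ⟨b1, b2⟩ := b
  rw [rel_iff] at *
  simp only [neg, TmaxPair.mk.injEq] at *
  tauto

theorem rel_balance {a b a' b' : TmaxPair Γ} (h : Rel a a') (h' : Rel b b') :
    Balance a b = Balance a' b' := by
  obtain ⟨a1, a2⟩ := a
  obtain ⟨b1, b2⟩ := b
  rw [rel_iff] at *
  simp only [Balance, Tmax.add_eq_max, eq_iff_iff] at *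
  grind

variable (Γ) in
/-- `Rel` is a congruence for both operations. -/
def con : RingCon (TmaxPair Γ) where
  r := Rel
  iseqv := rel_equivalence
  add' {a b c d} h h' := by
    refine rel_equivalence.trans (rel_add_right h c) ?_
    rw [add_comm b c, add_comm b d]
    exact rel_add_right h' b
  mul' {a b c d} h h' := by
    refine rel_equivalence.trans (rel_mul_right h c) ?_
    rw [mul_comm b c, mul_comm b d]
    exact rel_mul_right h' b

/-- The absolute value `|(a₁, a₂)| = a₁ ⊕ a₂`, a morphism of semirings. -/
def absHom : TmaxPair Γ →+* Tmax Γ where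
  toFun a := a.fst + a.snd
  map_zero' := by simp
  map_one' := by simp
  map_add' a b := by simp only [add_fst, add_snd]; ring
  map_mul' a b := by simp only [mul_fst, mul_snd]; ring

theorem rel_abs {a b : TmaxPair Γ} (h : Rel a b) : absHom a = absHom b := by
  rw [rel_iff] at h
  simp only [absHom, RingHom.coe_mk, MonoidHom.coe_mk, OneHom.coe_mk, Tmax.add_eq_max]
  grind

end TmaxPair

/-! ### The symmetrized tropical semiring -/

/-- The symmetrized tropical semiring `S_max(Γ)`, the quotient of the semiring
`T_max × T_max` by the congruence `TmaxPair.Rel`. -/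
abbrev Smax (Γ : Type*) [AddCommGroup Γ] [LinearOrder Γ] [IsOrderedAddMonoid Γ] : Type _ :=
  (TmaxPair.con Γ).Quotient

namespace Smax

variable {Γ : Type*} [AddCommGroup Γ] [LinearOrder Γ] [IsOrderedAddMonoid Γ]

/-- The class of the pair `(a₁, a₂)`. -/
def mk (a₁ a₂ : Tmax Γ) : Smax Γ := (TmaxPair.con Γ).mk' ⟨a₁, a₂⟩

/-- The minus operator `⊖`. -/
def neg : Smax Γ → Smax Γ :=
  Quotient.map TmaxPair.neg fun _ _ h => TmaxPair.rel_neg h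

/-- The balance relation `∇`. -/
def Balance : Smax Γ → Smax Γ → Prop :=
  Quotient.lift₂ TmaxPair.Balance fun _ _ _ _ h h' => TmaxPair.rel_balance h h'

/-- The absolute value `|a|`, a morphism of semirings to `T_max`. -/
def abs : Smax Γ →+* Tmax Γ :=
  (TmaxPair.con Γ).lift TmaxPair.absHom fun _ _ h => TmaxPair.rel_abs h

/-- The identification of `c ∈ T_max` with the class of `(c, ⊥)`. -/
def ofTmax (c : Tmax Γ) : Smax Γ := mk c 0

variable (Γ) in
/-- The set of positive or zero elements. -/
def nonneg : Set (Smax Γ) := {a | ∃ c : Tmax Γ, a = mk c 0}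

variable (Γ) in
/-- The set of negative or zero elements. -/
def nonpos : Set (Smax Γ) := {a | ∃ c : Tmax Γ, a = mk 0 c}

variable (Γ) in
/-- The set `S_max^∨` of signed elements: positive, negative or zero. -/
def signed : Set (Smax Γ) := nonneg Γ ∪ nonpos Γ

end Smax

/-! ### Corners of polynomials over the tropical semifield

Formal polynomials are elements of Mathlib's `Polynomial`; the associated polynomial function of
`P` is `fun y => P.eval y`. -/

/-- `c` is a corner of the formal polynomial `P` over `T_max`: for `c ≠ 0`, the maximum
`P.eval c = ⨁ₖ Pₖ cᵏ` is attained by two different monomials of `P`; for `c = 0`, `P` has no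
constant term. -/
def Tmax.IsCorner {Γ : Type*} [AddCommGroup Γ] [LinearOrder Γ] [IsOrderedAddMonoid Γ]
    (P : Polynomial (Tmax Γ)) (c : Tmax Γ) : Prop :=
  (c ≠ 0 ∧ ∃ i ∈ P.support, ∃ j ∈ P.support, i ≠ j ∧
      P.coeff i * c ^ i = P.eval c ∧ P.coeff j * c ^ j = P.eval c) ∨
    (c = 0 ∧ P.coeff 0 = 0)

/-- `k < l` are successive degrees of non-zero monomials of `P`. -/
def SuccessiveDegrees {R : Type*} [Semiring R] (P : Polynomial R) (k l : ℕ) : Prop :=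
  k < l ∧ P.coeff k ≠ 0 ∧ P.coeff l ≠ 0 ∧ ∀ i, k < i → i < l → P.coeff i = 0

/-! ### Polynomials over the symmetrized tropical semiring -/

namespace Smax

variable {Γ : Type*} [AddCommGroup Γ] [LinearOrder Γ] [IsOrderedAddMonoid Γ]

/-- All coefficients of `P` are signed, that is `P ∈ S_max^∨[Y]`. -/
def IsSignedPoly (P : Polynomial (Smax Γ)) : Prop := ∀ k, P.coeff k ∈ signed Γ

/-- The coefficientwise balance relation. -/
def PolyBalance (P Q : Polynomial (Smax Γ)) : Prop := ∀ k, Balance (P.coeff k) (Q.coeff k)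

/-- The coefficientwise absolute value `|P|`. -/
def absPoly (P : Polynomial (Smax Γ)) : Polynomial (Tmax Γ) := P.map abs

/-- The value of `P` at `a` balances zero. For signed `a`, this says that `a` is a root of `P`. -/
def IsRootOf (a : Smax Γ) (P : Polynomial (Smax Γ)) : Prop := Balance (P.eval a) 0

/-- `Q ∈ S_max^∨[Y]` satisfies `λ P ∇ (Y ⊖ a) Q` for some non-zero signed `λ`. -/
def IsQuotientBy (a : Smax Γ) (P Q : Polynomial (Smax Γ)) : Prop :=
  IsSignedPoly Q ∧ ∃ t ∈ signed Γ, t ≠ 0 ∧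
    PolyBalance (Polynomial.C t * P) ((Polynomial.X + Polynomial.C (neg a)) * Q)

/-- `MultGE a m P` says that the multiplicity of `a` in `P` is at least `m`. -/
def MultGE (a : Smax Γ) : ℕ → Polynomial (Smax Γ) → Prop
  | 0, _ => True
  | m + 1, P => IsRootOf a P ∧ (m = 0 ∨ ∃ Q, IsQuotientBy a P Q ∧ MultGE a m Q)

/-- The multiplicity of `a` as a root of `P`. It satisfies the recursion: it is `0` if `a` is not
a root of `P`, and `1` plus the supremum of the multiplicities of `a` in the polynomials `Q` with
`IsQuotientBy a P Q` otherwise (see `mult_of_not_isRootOf` and `mult_of_isRootOf`). -/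
def mult (a : Smax Γ) (P : Polynomial (Smax Γ)) : ℕ∞ := ⨆ (m : ℕ) (_ : MultGE a m P), (m : ℕ∞)

theorem mult_of_not_isRootOf {a : Smax Γ} {P : Polynomial (Smax Γ)} (h : ¬ IsRootOf a P) :
    mult a P = 0 := by
  refine le_antisymm (iSup₂_le fun m hm => ?_) zero_le
  cases m with
  | zero => simp
  | succ m => exact absurd hm.1 h

theorem mult_of_isRootOf {a : Smax Γ} {P : Polynomial (Smax Γ)} (h : IsRootOf a P) :
    mult a P = 1 + ⨆ (Q : Polynomial (Smax Γ)) (_ : IsQuotientBy a P Q), mult a Q := by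
  apply le_antisymm
  · refine iSup₂_le fun m hm => ?_
    cases m with
    | zero => simp
    | succ m =>
      rw [Nat.cast_add, Nat.cast_one, add_comm]
      gcongr
      rcases hm.2 with rfl | ⟨Q, hQ, hm⟩
      · simp
      · exact le_iSup₂_of_le Q hQ (le_iSup₂_of_le (f := fun (m : ℕ) (_ : MultGE a m Q) =>
          (m : ℕ∞)) m hm le_rfl)
  · have h1 : (1 : ℕ∞) ≤ mult a P :=
      le_iSup₂_of_le (f := fun (m : ℕ) (_ : MultGE a m P) => (m : ℕ∞)) 1 ⟨h, Or.inl rfl⟩ (by simp)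
    rw [← tsub_add_cancel_of_le h1, add_comm (_ - _)]
    gcongr
    refine iSup₂_le fun Q hQ => iSup₂_le fun m hm => ?_
    refine ENat.le_sub_of_add_le_left (by simp) ?_
    exact le_iSup₂_of_le (f := fun (m : ℕ) (_ : MultGE a m P) => (m : ℕ∞)) (m + 1)
      ⟨h, Or.inr ⟨Q, hQ, hm⟩⟩ (by simp [add_comm])

open Classical in
/-- `P` has `n` roots counted with multiplicity: there are signed `r₁, …, rₙ` in which each signed
`a` occurs exactly as often as its multiplicity as a root of `P`. -/
def HasRootsWithMult (P : Polynomial (Smax Γ)) (n : ℕ) : Prop :=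
  ∃ r : Fin n → Smax Γ, (∀ i, r i ∈ signed Γ) ∧
    ∀ a ∈ signed Γ, ((Finset.univ.filter fun i => r i = a).card : ℕ∞) = mult a P

open Classical in
/-- The saturation set of `P` at `r`: the degrees `i` with `|P.eval r| = |Pᵢ| |r|ⁱ`. -/
def sat (r : Smax Γ) (P : Polynomial (Smax Γ)) : Finset ℕ :=
  (Finset.range (P.natDegree + 1)).filter fun i =>
    abs (P.eval r) = abs (P.coeff i) * abs r ^ i

/-- The saturation polynomial of `P` at `r`: the monomials with degree `i` in the saturation set,
with coefficients `|P.eval r|⁻¹ rⁱ Pᵢ`. -/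
def satPoly (P : Polynomial (Smax Γ)) (r : Smax Γ) : Polynomial (Smax Γ) :=
  ∑ i ∈ sat r P, Polynomial.monomial i (ofTmax (abs (P.eval r))⁻¹ * r ^ i * P.coeff i)

end Smax

end

noncomputable section

/-! ### Elementary facts on the symmetrized tropical semiring -/

namespace Smax

variable {Γ : Type*} [AddCommGroup Γ] [LinearOrder Γ] [IsOrderedAddMonoid Γ]

/-! For a non-zero signed a, the substitution Y → aY moves the root a to 1. Call a degree of F =
P(aY) dominant if its coefficient has maximal absolute value. A sum of signed terms, not all zero,
balances zero exactly when the maximum is attained with both signs (`balance_sum_zero_iff`), so a is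
a root iff the dominant coefficients of F change sign. A tropical Descartes rule sharpens this: the
multiplicity of a is the number of sign changes along the dominant coefficients
(`multGE_iff_le_card`). Indeed, multiplication by Y ⊖ 1 creates at least one sign change
(`IsDifference.card_signChanges_lt`), and some quotient loses only one (`exists_isDifference`). The
multiplicity of the root zero is the order of P.

For c in Γ, the dominant degrees of P(cY) form sat(c, P). Passing from c to ⊖c multiplies the
relative sign at successive dominant degrees k < l by (⊖1)^(l-k). If l - k is odd, exactly one of c
and ⊖c has a sign change at l; if it is even, both or neither do. The block (k, l] thus carries at
most l - k sign changes, with equality iff l - k = 1, or l - k = 2 and the coefficients are opposite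
(`card_add_card_signChanges_eq_iff`).

Since Γ is divisible, the Newton polygon has its slopes in Γ, and the blocks at all corners
partition the degrees above the order of P (`exists_corners`). The multiplicities therefore add up
to at most deg P, with equality iff the bound is attained in every block (`hasRootsWithMult_iff`).
-/

theorem exists_eq_mk (x : Smax Γ) : ∃ a b, x = mk a b := by
  obtain ⟨⟨a, b⟩, rfl⟩ := (TmaxPair.con Γ).mk'_surjective x
  exact ⟨a, b, rfl⟩

theorem mk_eq_mk {a b c d : Tmax Γ} : mk a b = mk c d ↔
    (b < a ∧ d < c ∧ a = c) ∨ (a < b ∧ c < d ∧ b = d) ∨ (a = c ∧ b = d) := by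
  have : mk a b = mk c d ↔ TmaxPair.Rel (⟨a, b⟩ : TmaxPair Γ) ⟨c, d⟩ :=
    (RingCon.eq (TmaxPair.con Γ))
  rw [this, TmaxPair.rel_iff]
  simp

theorem zero_eq_mk : (0 : Smax Γ) = mk 0 0 := rfl

theorem one_eq_mk : (1 : Smax Γ) = mk 1 0 := rfl

theorem mk_add_mk (a b c d : Tmax Γ) : mk a b + mk c d = mk (a + c) (b + d) := rfl

theorem mk_mul_mk (a b c d : Tmax Γ) : mk a b * mk c d = mk (a * c + b * d) (a * d + b * c) := rfl

theorem neg_mk (a b : Tmax Γ) : neg (mk a b) = mk b a := rfl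

theorem abs_mk (a b : Tmax Γ) : abs (mk a b) = max a b := rfl

theorem balance_mk (a b c d : Tmax Γ) : Balance (mk a b) (mk c d) ↔ a + d = b + c := Iff.rfl

theorem signed_cases {x : Smax Γ} (hx : x ∈ signed Γ) : ∃ c, x = mk c 0 ∨ x = mk 0 c := by
  rcases hx with ⟨c, rfl⟩ | ⟨c, rfl⟩
  · exact ⟨c, Or.inl rfl⟩
  · exact ⟨c, Or.inr rfl⟩

theorem mk_left_mem_signed (c : Tmax Γ) : mk c 0 ∈ signed Γ := Or.inl ⟨c, rfl⟩

theorem mk_right_mem_signed (c : Tmax Γ) : mk 0 c ∈ signed Γ := Or.inr ⟨c, rfl⟩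

theorem ofTmax_mem_signed (c : Tmax Γ) : ofTmax c ∈ signed Γ := mk_left_mem_signed c

theorem zero_mem_signed : (0 : Smax Γ) ∈ signed Γ := mk_left_mem_signed 0

theorem one_mem_signed : (1 : Smax Γ) ∈ signed Γ := mk_left_mem_signed 1

theorem neg_mem_signed {x : Smax Γ} (hx : x ∈ signed Γ) : neg x ∈ signed Γ := by
  obtain ⟨c, rfl | rfl⟩ := signed_cases hx
  · exact mk_right_mem_signed c
  · exact mk_left_mem_signed c

theorem mul_mem_signed {x y : Smax Γ} (hx : x ∈ signed Γ) (hy : y ∈ signed Γ) :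
    x * y ∈ signed Γ := by
  obtain ⟨c, rfl | rfl⟩ := signed_cases hx <;> obtain ⟨d, rfl | rfl⟩ := signed_cases hy <;>
    simp [mk_mul_mk, mk_left_mem_signed, mk_right_mem_signed]

theorem pow_mem_signed {x : Smax Γ} (hx : x ∈ signed Γ) (k : ℕ) : x ^ k ∈ signed Γ := by
  induction k with
  | zero => simpa using one_mem_signed
  | succ k ih => rw [pow_succ]; exact mul_mem_signed ih hx

@[simp] theorem neg_neg (x : Smax Γ) : neg (neg x) = x := by
  obtain ⟨a, b, rfl⟩ := exists_eq_mk x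
  rfl

@[simp] theorem neg_zero : neg (0 : Smax Γ) = 0 := rfl

theorem neg_eq_mul (x : Smax Γ) : neg x = neg 1 * x := by
  obtain ⟨a, b, rfl⟩ := exists_eq_mk x
  simp [one_eq_mk, neg_mk, mk_mul_mk]

theorem mul_neg (x y : Smax Γ) : x * neg y = neg (x * y) := by
  rw [neg_eq_mul y, neg_eq_mul (x * y)]; ring

theorem neg_mul (x y : Smax Γ) : neg x * y = neg (x * y) := by
  rw [neg_eq_mul x, neg_eq_mul (x * y)]; ring

theorem neg_inj {x y : Smax Γ} : neg x = neg y ↔ x = y :=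
  ⟨fun h => by rw [← neg_neg x, h, neg_neg], fun h => h ▸ rfl⟩

@[simp] theorem abs_neg (x : Smax Γ) : abs (neg x) = abs x := by
  obtain ⟨a, b, rfl⟩ := exists_eq_mk x
  rw [neg_mk, abs_mk, abs_mk, max_comm]

@[simp] theorem abs_ofTmax (c : Tmax Γ) : abs (ofTmax c) = c := by
  simp [ofTmax, abs_mk]

@[simp] theorem abs_eq_zero {x : Smax Γ} : abs x = 0 ↔ x = 0 := by
  obtain ⟨a, b, rfl⟩ := exists_eq_mk x
  rw [abs_mk, zero_eq_mk, mk_eq_mk]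
  have := zero_le (a := a)
  have := zero_le (a := b)
  grind

theorem neg_eq_zero {x : Smax Γ} : neg x = 0 ↔ x = 0 := by
  rw [← abs_eq_zero, abs_neg, abs_eq_zero]

theorem ofTmax_ne_zero {c : Tmax Γ} (hc : c ≠ 0) : ofTmax c ≠ 0 := by
  rwa [Ne, ← abs_eq_zero, abs_ofTmax]

theorem mul_ne_zero' {x y : Smax Γ} (hx : x ≠ 0) (hy : y ≠ 0) : x * y ≠ 0 := by
  rw [Ne, ← abs_eq_zero, map_mul]
  exact mul_ne_zero (by simpa using hx) (by simpa using hy)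

theorem pow_ne_zero' {x : Smax Γ} (hx : x ≠ 0) (k : ℕ) : x ^ k ≠ 0 := by
  rw [Ne, ← abs_eq_zero, map_pow]
  exact pow_ne_zero k (by simpa using hx)

theorem ofTmax_mul (c d : Tmax Γ) : ofTmax (c * d) = ofTmax c * ofTmax d := by
  simp [ofTmax, mk_mul_mk]

theorem ofTmax_one : ofTmax (1 : Tmax Γ) = 1 := rfl

/-- Non-zero signed elements are invertible. -/
theorem exists_inv {x : Smax Γ} (hx : x ∈ signed Γ) (h0 : x ≠ 0) :
    ∃ y ∈ signed Γ, y ≠ 0 ∧ x * y = 1 := by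
  obtain ⟨c, rfl | rfl⟩ := signed_cases hx <;> have hc : c ≠ 0 := by rintro rfl; exact h0 rfl
  · refine ⟨mk c⁻¹ 0, mk_left_mem_signed _, ofTmax_ne_zero (inv_ne_zero hc), ?_⟩
    simp [mk_mul_mk, hc, one_eq_mk]
  · refine ⟨mk 0 c⁻¹, mk_right_mem_signed _, ?_, ?_⟩
    · exact fun h => ofTmax_ne_zero (inv_ne_zero hc) (neg_eq_zero.1 h)
    · simp [mk_mul_mk, hc, one_eq_mk]

theorem mul_left_inj_signed {t x y : Smax Γ} (ht : t ∈ signed Γ) (h0 : t ≠ 0) :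
    t * x = t * y ↔ x = y := by
  refine ⟨fun h => ?_, fun h => h ▸ rfl⟩
  obtain ⟨s, -, -, hs⟩ := exists_inv ht h0
  have := congrArg (s * ·) h
  simpa [← mul_assoc, mul_comm s t, hs] using this

theorem eq_or_eq_neg_of_abs_eq {x y : Smax Γ} (hx : x ∈ signed Γ) (hy : y ∈ signed Γ)
    (h : abs x = abs y) : x = y ∨ x = neg y := by
  obtain ⟨c, rfl | rfl⟩ := signed_cases hx <;> obtain ⟨d, rfl | rfl⟩ := signed_cases hy <;>
    simp_all [abs_mk, neg_mk]

/-- Signedness matters: a balanced element such as `mk c c` is its own opposite. -/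
theorem ne_neg_self {x : Smax Γ} (hx : x ∈ signed Γ) (h0 : x ≠ 0) : x ≠ neg x := by
  obtain ⟨c, rfl | rfl⟩ := signed_cases hx <;>
    · rw [zero_eq_mk] at h0
      rw [neg_mk]
      simp only [Ne, mk_eq_mk] at *
      have := zero_le (a := c)
      grind

theorem eq_of_ne_neg {x y : Smax Γ} (hx : x ∈ signed Γ) (hy : y ∈ signed Γ)
    (h : abs x = abs y) (hne : x ≠ neg y) : x = y :=
  (eq_or_eq_neg_of_abs_eq hx hy h).resolve_right hne

theorem eq_neg_comm {x y : Smax Γ} : x = neg y ↔ y = neg x := by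
  rw [← neg_inj, neg_neg, eq_comm]

/-- Balanced signed elements are equal. -/
theorem eq_of_balance {x y : Smax Γ} (hx : x ∈ signed Γ) (hy : y ∈ signed Γ)
    (h : Balance x y) : x = y := by
  obtain ⟨c, rfl | rfl⟩ := signed_cases hx <;> obtain ⟨d, rfl | rfl⟩ := signed_cases hy <;>
    · rw [balance_mk, Tmax.add_eq_max, Tmax.add_eq_max] at h
      rw [mk_eq_mk]
      have := zero_le (a := c)
      have := zero_le (a := d)
      grind

theorem balance_refl (x : Smax Γ) : Balance x x := by
  obtain ⟨a, b, rfl⟩ := exists_eq_mk x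
  rw [balance_mk, add_comm]

/-- The new equation is `e` times the given one plus `f` times its mirror image. -/
theorem balance_mul_left {x y : Smax Γ} (t : Smax Γ) (h : Balance x y) :
    Balance (t * x) (t * y) := by
  obtain ⟨a, b, rfl⟩ := exists_eq_mk x
  obtain ⟨c, d, rfl⟩ := exists_eq_mk y
  obtain ⟨e, f, rfl⟩ := exists_eq_mk t
  rw [mk_mul_mk, mk_mul_mk, balance_mk]
  rw [balance_mk] at h
  calc e * a + f * b + (e * d + f * c) = e * (a + d) + f * (b + c) := by ring
    _ = e * (b + c) + f * (a + d) := by rw [h]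
    _ = _ := by ring

/-! ### Signed elements balancing a difference -/

section Difference

variable {p q q' : Smax Γ}

theorem abs_le_of_balance (hp : p ∈ signed Γ) (hq : q ∈ signed Γ) (hq' : q' ∈ signed Γ)
    (h : Balance p (q' + neg q)) : abs p ≤ max (abs q') (abs q) := by
  obtain ⟨a, rfl | rfl⟩ := signed_cases hp <;> obtain ⟨b, rfl | rfl⟩ := signed_cases hq <;>
    obtain ⟨c, rfl | rfl⟩ := signed_cases hq' <;>
    · have := zero_le (a := a)
      have := zero_le (a := b)
      have := zero_le (a := c)
      simp only [neg_mk, mk_add_mk, balance_mk, Tmax.add_eq_max, abs_mk] at *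
      grind

theorem eq_neg_of_balance (hp : p ∈ signed Γ) (hq : q ∈ signed Γ) (hq' : q' ∈ signed Γ)
    (h : Balance p (q' + neg q)) (hlt : abs q' < abs q) : p = neg q := by
  obtain ⟨a, rfl | rfl⟩ := signed_cases hp <;> obtain ⟨b, rfl | rfl⟩ := signed_cases hq <;>
    obtain ⟨c, rfl | rfl⟩ := signed_cases hq' <;>
    · have := zero_le (a := a)
      have := zero_le (a := b)
      have := zero_le (a := c)
      simp only [neg_mk, mk_add_mk, balance_mk, Tmax.add_eq_max, abs_mk, mk_eq_mk] at *
      grind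

theorem eq_of_balance_of_lt (hp : p ∈ signed Γ) (hq : q ∈ signed Γ) (hq' : q' ∈ signed Γ)
    (h : Balance p (q' + neg q)) (hlt : abs q < abs q') : p = q' := by
  obtain ⟨a, rfl | rfl⟩ := signed_cases hp <;> obtain ⟨b, rfl | rfl⟩ := signed_cases hq <;>
    obtain ⟨c, rfl | rfl⟩ := signed_cases hq' <;>
    · have := zero_le (a := a)
      have := zero_le (a := b)
      have := zero_le (a := c)
      simp only [neg_mk, mk_add_mk, balance_mk, Tmax.add_eq_max, abs_mk, mk_eq_mk] at *
      grind

theorem eq_neg_of_balance_of_eq_neg (hp : p ∈ signed Γ) (hq : q ∈ signed Γ)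
    (h : Balance p (neg q + neg q)) : p = neg q := by
  obtain ⟨a, rfl | rfl⟩ := signed_cases hp <;> obtain ⟨b, rfl | rfl⟩ := signed_cases hq <;>
    · have := zero_le (a := a)
      have := zero_le (a := b)
      simp only [neg_mk, mk_add_mk, balance_mk, Tmax.add_eq_max, mk_eq_mk] at *
      grind

/-- The sum is either `p` or the balanced element of modulus `abs p`, and both balance `p`. This
freedom is what makes division by Y ⊖ 1 possible. -/
theorem balance_add_self (hp : p ∈ signed Γ) (hq' : q' ∈ signed Γ) (h : abs q' ≤ abs p) :
    Balance p (q' + p) := by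
  obtain ⟨a, rfl | rfl⟩ := signed_cases hp <;>
    obtain ⟨c, rfl | rfl⟩ := signed_cases hq' <;>
    · have := zero_le (a := a)
      have := zero_le (a := c)
      simp only [mk_add_mk, balance_mk, Tmax.add_eq_max, abs_mk] at *
      grind

/-- The difference of `q` with itself is the balanced element of modulus `abs q`, which balances
every signed element of at most that modulus. -/
theorem balance_sub_self (hp : p ∈ signed Γ) (hq : q ∈ signed Γ) (h : abs p ≤ abs q) :
    Balance p (q + neg q) := by
  obtain ⟨a, rfl | rfl⟩ := signed_cases hp <;>
    obtain ⟨c, rfl | rfl⟩ := signed_cases hq <;>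
    · have := zero_le (a := a)
      have := zero_le (a := c)
      simp only [neg_mk, mk_add_mk, balance_mk, Tmax.add_eq_max, abs_mk] at *
      grind

end Difference

end Smax

/-! ### Finite sums in the tropical semifield -/

namespace Tmax

variable {Γ : Type*} [AddCommGroup Γ] [LinearOrder Γ] [IsOrderedAddMonoid Γ] {ι : Type*}

theorem le_sum (s : Finset ι) (f : ι → Tmax Γ) {i : ι} (hi : i ∈ s) : f i ≤ ∑ j ∈ s, f j := by
  classical
  rw [← Finset.add_sum_erase s f hi, add_eq_max]
  exact le_max_left _ _

theorem sum_le (s : Finset ι) (f : ι → Tmax Γ) {M : Tmax Γ} (h : ∀ i ∈ s, f i ≤ M) :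
    ∑ j ∈ s, f j ≤ M := by
  classical
  induction s using Finset.induction_on with
  | empty => simp
  | insert a s ha ih =>
    rw [Finset.sum_insert ha, add_eq_max]
    exact max_le (h a (by simp)) (ih fun i hi => h i (by simp [hi]))

theorem exists_eq_sum (s : Finset ι) (f : ι → Tmax Γ) (h : ∑ j ∈ s, f j ≠ 0) :
    ∃ i ∈ s, f i = ∑ j ∈ s, f j := by
  classical
  induction s using Finset.induction_on with
  | empty => simp at h
  | insert a s ha ih =>
    rw [Finset.sum_insert ha, add_eq_max] at *
    rcases max_cases (f a) (∑ j ∈ s, f j) with ⟨h1, h2⟩ | ⟨h1, h2⟩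
    · exact ⟨a, by simp, h1.symm⟩
    · rw [h1] at h ⊢
      obtain ⟨i, hi, hi'⟩ := ih h
      exact ⟨i, by simp [hi], hi'⟩

end Tmax

namespace Smax

variable {Γ : Type*} [AddCommGroup Γ] [LinearOrder Γ] [IsOrderedAddMonoid Γ] {ι : Type*}

theorem sum_mk (s : Finset ι) (f g : ι → Tmax Γ) :
    ∑ i ∈ s, mk (f i) (g i) = mk (∑ i ∈ s, f i) (∑ i ∈ s, g i) := by
  classical
  induction s using Finset.induction_on with
  | empty => rfl
  | insert a s ha ih => simp_rw [Finset.sum_insert ha, ih, mk_add_mk]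

/-- A sum of signed elements is balanced with zero if and only if the maximal absolute value is
attained with both signs, or all terms vanish. -/
theorem balance_sum_zero_iff (s : Finset ι) (x : ι → Smax Γ) (hx : ∀ i ∈ s, x i ∈ signed Γ)
    (h0 : ∃ i ∈ s, x i ≠ 0) :
    Balance (∑ i ∈ s, x i) 0 ↔
      ∃ i ∈ s, ∃ j ∈ s, x i = neg (x j) ∧ ∀ k ∈ s, abs (x k) ≤ abs (x i) := by
  -- Each term is a pair with a zero component; the value outside `s` only makes the choice total.
  have : ∀ i, ∃ a b, i ∈ s → (x i = mk a b ∧ (a = 0 ∨ b = 0)) := by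
    intro i
    by_cases hi : i ∈ s
    · obtain ⟨c, h | h⟩ := signed_cases (hx i hi)
      · exact ⟨c, 0, fun _ => ⟨h, Or.inr rfl⟩⟩
      · exact ⟨0, c, fun _ => ⟨h, Or.inl rfl⟩⟩
    · exact ⟨0, 0, fun h => absurd h hi⟩
  choose a b hab using this
  rw [Finset.sum_congr rfl fun i hi => (hab i hi).1, sum_mk, zero_eq_mk, balance_mk, add_zero,
    add_zero]
  have habs : ∀ i ∈ s, abs (x i) = max (a i) (b i) := fun i hi => by rw [(hab i hi).1, abs_mk]
  constructor
  · intro h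
    have hM : ∑ i ∈ s, a i ≠ 0 := by
      intro hM
      obtain ⟨i, hi, hi0⟩ := h0
      refine hi0 ?_
      have h1 := Tmax.le_sum s a hi
      have h2 := Tmax.le_sum s b hi
      rw [← h] at h2
      rw [hM] at h1 h2
      rw [(hab i hi).1, le_antisymm h1 zero_le, le_antisymm h2 zero_le, zero_eq_mk]
    obtain ⟨i, hi, hi'⟩ := Tmax.exists_eq_sum s a hM
    obtain ⟨j, hj, hj'⟩ := Tmax.exists_eq_sum s b (h ▸ hM)
    have hbi : b i = 0 := (hab i hi).2.resolve_left (hi' ▸ hM)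
    have haj : a j = 0 := (hab j hj).2.resolve_right (hj' ▸ h ▸ hM)
    refine ⟨i, hi, j, hj, ?_, fun k hk => ?_⟩
    · rw [(hab i hi).1, (hab j hj).1, neg_mk, hbi, haj, hi', hj', h]
    · rw [habs k hk, habs i hi, hi']
      exact le_max_of_le_left (max_le (Tmax.le_sum s a hk) (h ▸ Tmax.le_sum s b hk))
  · rintro ⟨i, hi, j, hj, hij, hmax⟩
    have hle : ∀ k ∈ s, a k ≤ abs (x i) ∧ b k ≤ abs (x i) := fun k hk => by
      have := hmax k hk
      rwa [habs k hk, max_le_iff] at this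
    -- Of two opposite terms, one carries the modulus in its first component and the other in its
    -- second.
    have key : ∀ i ∈ s, ∀ j ∈ s, x i = neg (x j) → abs (x i) ≤ ∑ i ∈ s, a i := by
      intro i hi j hj hij
      have h1 := Tmax.le_sum s a hi
      have h2 := Tmax.le_sum s a hj
      have h3 := habs i hi
      have h4 := habs j hj
      rw [hij, abs_neg] at h3 ⊢
      rw [(hab i hi).1, (hab j hj).1, neg_mk, mk_eq_mk] at hij
      have h5 := (hab i hi).2
      have h6 := (hab j hj).2
      have := zero_le (a := a i)
      have := zero_le (a := a j)
      have := zero_le (a := b i)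
      have := zero_le (a := b j)
      grind
    have key' : ∀ i ∈ s, ∀ j ∈ s, x i = neg (x j) → abs (x i) ≤ ∑ i ∈ s, b i := by
      intro i hi j hj hij
      have h1 := Tmax.le_sum s b hi
      have h2 := Tmax.le_sum s b hj
      have h3 := habs i hi
      have h4 := habs j hj
      rw [hij, abs_neg] at h3 ⊢
      rw [(hab i hi).1, (hab j hj).1, neg_mk, mk_eq_mk] at hij
      have h5 := (hab i hi).2
      have h6 := (hab j hj).2
      have := zero_le (a := a i)
      have := zero_le (a := a j)
      have := zero_le (a := b i)
      have := zero_le (a := b j)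
      grind
    rw [le_antisymm (Tmax.sum_le s a fun k hk => (hle k hk).1) (key i hi j hj hij),
      le_antisymm (Tmax.sum_le s b fun k hk => (hle k hk).2) (key' i hi j hj hij)]

end Smax

/-! ### Sign changes on the saturation set -/

namespace Smax

open Polynomial

variable {Γ : Type*} [AddCommGroup Γ] [LinearOrder Γ] [IsOrderedAddMonoid Γ]

open Classical in
/-- The degrees of the monomials of `F` whose coefficients have maximal absolute value. -/
def dominant (F : (Smax Γ)[X]) : Finset ℕ :=
  F.support.filter fun l => ∀ i, abs (F.coeff i) ≤ abs (F.coeff l)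

open Classical in
/-- The dominant degrees `l` of `F` for which the preceding dominant coefficient is
`⊖ F.coeff l`. -/
def signChanges (F : (Smax Γ)[X]) : Finset ℕ :=
  (dominant F).filter fun l => ∃ k < l, F.coeff k = neg (F.coeff l) ∧
    ∀ i, k < i → i < l → abs (F.coeff i) < abs (F.coeff l)

variable {F G : (Smax Γ)[X]}

theorem mem_dominant {l : ℕ} :
    l ∈ dominant F ↔ F.coeff l ≠ 0 ∧ ∀ i, abs (F.coeff i) ≤ abs (F.coeff l) := by
  simp [dominant]

theorem mem_signChanges {l : ℕ} : l ∈ signChanges F ↔ l ∈ dominant F ∧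
    ∃ k < l, F.coeff k = neg (F.coeff l) ∧
      ∀ i, k < i → i < l → abs (F.coeff i) < abs (F.coeff l) := by
  simp [signChanges]

theorem abs_eq_of_mem_dominant {k l : ℕ} (hk : k ∈ dominant F) (hl : l ∈ dominant F) :
    abs (F.coeff k) = abs (F.coeff l) :=
  le_antisymm ((mem_dominant.1 hl).2 k) ((mem_dominant.1 hk).2 l)

theorem mem_dominant_of_abs_eq {k l : ℕ} (hl : l ∈ dominant F)
    (h : abs (F.coeff k) = abs (F.coeff l)) : k ∈ dominant F := by
  rw [mem_dominant] at *
  rw [h]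
  refine ⟨fun h0 => hl.1 ?_, hl.2⟩
  rwa [← abs_eq_zero, ← h, abs_eq_zero]

theorem abs_lt_of_notMem_dominant {k l : ℕ} (hl : l ∈ dominant F) (hk : k ∉ dominant F) :
    abs (F.coeff k) < abs (F.coeff l) :=
  lt_of_le_of_ne ((mem_dominant.1 hl).2 k) fun h => hk (mem_dominant_of_abs_eq hl h)

theorem dominant_nonempty (h : F ≠ 0) : (dominant F).Nonempty := by
  obtain ⟨l, hl, hmax⟩ := F.support.exists_max_image (fun i => abs (F.coeff i))
    (support_nonempty.2 h)
  refine ⟨l, mem_dominant.2 ⟨mem_support_iff.1 hl, fun i => ?_⟩⟩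
  by_cases hi : F.coeff i = 0
  · simp [hi]
  · exact hmax i (mem_support_iff.2 hi)

/-- The criterion of sign change in terms of the preceding dominant degree. -/
theorem mem_signChanges_iff_of_successive {k l : ℕ} (hk : k ∈ dominant F)
    (hl : l ∈ dominant F) (hkl : k < l) (hb : ∀ i, k < i → i < l → i ∉ dominant F) :
    l ∈ signChanges F ↔ F.coeff k = neg (F.coeff l) := by
  rw [mem_signChanges]
  refine ⟨fun ⟨_, k', hk', h1, h2⟩ => ?_, fun h => ⟨hl, k, hkl, h, fun i hi hi' =>
    abs_lt_of_notMem_dominant hl (hb i hi hi')⟩⟩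
  have hk'm : k' ∈ dominant F := mem_dominant_of_abs_eq hl (by rw [h1, abs_neg])
  rcases lt_trichotomy k k' with h | rfl | h
  · exact absurd hk'm (hb k' h hk')
  · exact h1
  · exact absurd (abs_eq_of_mem_dominant hk hl) (h2 k h hkl).ne

/-- Between two dominant coefficients with opposite signs there is a sign change. -/
theorem exists_mem_signChanges (hF : IsSignedPoly F) {a b : ℕ} (hab : a < b)
    (hb : b ∈ dominant F) (h : F.coeff a = neg (F.coeff b)) :
    ∃ l ∈ signChanges F, a < l ∧ l ≤ b := by
  obtain ⟨d, hd⟩ : ∃ d, b - a = d := ⟨_, rfl⟩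
  induction d using Nat.strong_induction_on generalizing a b with
  | _ d ih =>
    have ha : a ∈ dominant F := mem_dominant_of_abs_eq hb (by rw [h, abs_neg])
    -- Cut at an intermediate dominant degree: its sign is opposite to that at `a` or to that at
    -- `b`.
    by_cases hex : ∃ i, a < i ∧ i < b ∧ i ∈ dominant F
    · obtain ⟨i, hai, hib, hi⟩ := hex
      by_cases hi' : F.coeff a = neg (F.coeff i)
      · obtain ⟨l, hl, h1, h2⟩ := ih (i - a) (by omega) hai hi hi' rfl
        exact ⟨l, hl, h1, by omega⟩
      · have := eq_of_ne_neg (hF a) (hF i) (abs_eq_of_mem_dominant ha hi) hi'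
        obtain ⟨l, hl, h1, h2⟩ := ih (b - i) (by omega) hib hb (this ▸ h) rfl
        exact ⟨l, hl, by omega, h2⟩
    · exact ⟨b, (mem_signChanges_iff_of_successive ha hb hab
        fun i h1 h2 h3 => hex ⟨i, h1, h2, h3⟩).2 h, hab, le_rfl⟩

/-- A set of dominant degrees on which the signs alternate has at most one element more than the
set of sign changes. -/
theorem card_le_card_signChanges_add_one (hF : IsSignedPoly F) (D : Finset ℕ)
    (hD : ∀ d ∈ D, d ∈ dominant F)
    (halt : ∀ a ∈ D, ∀ b ∈ D, a < b → (∀ i ∈ D, ¬ (a < i ∧ i < b)) →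
      F.coeff a = neg (F.coeff b)) :
    D.card ≤ (signChanges F).card + 1 := by
  -- The count is localized below an upper bound `m` of `D`, so that a new maximum of `D` can
  -- contribute a sign change beyond those already counted. The first alternative means that `D` has
  -- at most one element.
  suffices h : ∀ m, (∀ d ∈ D, d ≤ m) → (∀ x ∈ D, m ≤ x) ∨
      D.card ≤ ((signChanges F).filter (· ≤ m)).card + 1 by
    by_cases hne : D.Nonempty
    · rcases h (D.max' hne) (fun d hd => D.le_max' d hd) with h | h
      · have : D.card ≤ 1 := Finset.card_le_one.2 fun a ha b hb => by
          have := h a ha; have := h b hb; have := D.le_max' a ha; have := D.le_max' b hb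
          omega
        omega
      · exact h.trans (Nat.add_le_add_right (Finset.card_filter_le _ _) 1)
    · simp [Finset.not_nonempty_iff_eq_empty.1 hne]
  induction D using Finset.induction_on_max with
  | empty => simp
  | insert a D ha ih =>
    intro m hm
    right
    have haD : a ∉ D := fun h => lt_irrefl a (ha a h)
    rw [Finset.card_insert_of_notMem haD]
    rcases D.eq_empty_or_nonempty with rfl | hne
    · simp
    have hbD := D.max'_mem hne
    have hb : ∀ d ∈ D, d ≤ D.max' hne := fun d hd => D.le_max' d hd
    set b := D.max' hne
    have hcard : D.card ≤ ((signChanges F).filter (· ≤ b)).card + 1 := by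
      rcases ih (fun d hd => hD d (by simp [hd])) (fun x hx y hy hxy hi =>
        halt x (by simp [hx]) y (by simp [hy]) hxy fun i hi' hlt => by
          rcases Finset.mem_insert.1 hi' with rfl | hi'
          · have := ha y hy; omega
          · exact hi i hi' hlt) b hb with h | h
      · have : D.card ≤ 1 := Finset.card_le_one.2 fun x hx y hy => by
          have := h x hx; have := h y hy; have := hb x hx; have := hb y hy
          omega
        omega
      · exact h
    obtain ⟨l, hl, h1, h2⟩ := exists_mem_signChanges hF (ha b hbD) (hD a (by simp))
      (halt b (by simp [hbD]) a (by simp) (ha b hbD) fun i hi hlt => by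
        rcases Finset.mem_insert.1 hi with rfl | hi
        · omega
        · have := hb i hi; omega)
    -- The sign change `l` lies in (b, a], hence is counted for `m` but not for `b`.
    have : ((signChanges F).filter (· ≤ b)).card < ((signChanges F).filter (· ≤ m)).card := by
      apply Finset.card_lt_card
      rw [Finset.ssubset_iff_of_subset]
      · exact ⟨l, by have := hm a (by simp); simp [hl]; omega, by simp; omega⟩
      · intro x hx
        have := hm a (by simp)
        have := ha b hbD
        simp only [Finset.mem_filter] at *
        exact ⟨hx.1, by omega⟩
    omega

/-! ### Multiplication by Y ⊖ 1 -/

/-- `F ∇ (Y ⊖ 1) G` in terms of coefficients. -/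
def IsDifference (F G : (Smax Γ)[X]) : Prop :=
  Balance (F.coeff 0) (neg (G.coeff 0)) ∧
    ∀ k, Balance (F.coeff (k + 1)) (G.coeff k + neg (G.coeff (k + 1)))

/-- The number of sign changes increases by at least one under multiplication by `Y ⊖ 1`. -/
theorem IsDifference.card_signChanges_lt (hF : IsSignedPoly F) (hG : IsSignedPoly G)
    (hG0 : G ≠ 0) (h : IsDifference F G) :
    (signChanges G).card + 1 ≤ (signChanges F).card := by
  have hne := dominant_nonempty hG0
  have hm := (dominant G).min'_mem hne
  have hm' : ∀ l ∈ dominant G, (dominant G).min' hne ≤ l := fun l hl => Finset.min'_le _ _ hl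
  have ht := (dominant G).max'_mem hne
  have ht' : ∀ l ∈ dominant G, l ≤ (dominant G).max' hne := fun l hl => Finset.le_max' _ _ hl
  set m := (dominant G).min' hne
  set t := (dominant G).max' hne
  -- Below `m` the coefficients of `G` are strictly smaller, so `G.coeff m` alone decides this
  -- coefficient of `F`.
  have hFm : F.coeff m = neg (G.coeff m) := by
    have hlt : ∀ i < m, abs (G.coeff i) < abs (G.coeff m) := fun i hi =>
      abs_lt_of_notMem_dominant hm fun hi' => by have := hm' i hi'; omega
    cases hmm : m with
    | zero => exact eq_of_balance (hF _) (neg_mem_signed (hG _)) h.1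
    | succ j =>
      rw [hmm] at hlt
      exact eq_neg_of_balance (hF _) (hG _) (hG _) (h.2 j) (hlt j (by omega))
  -- By maximality of `t`, the next coefficient of `G` is too small to interfere with `G.coeff t`.
  have hFt : F.coeff (t + 1) = G.coeff t :=
    eq_of_balance_of_lt (hF _) (hG _) (hG _) (h.2 t)
      (abs_lt_of_notMem_dominant ht fun hi' => by have := ht' _ hi'; omega)
  have hFle : ∀ i, abs (F.coeff i) ≤ abs (G.coeff m) := by
    intro i
    have hGm := (mem_dominant.1 hm).2
    cases i with
    | zero =>
      rw [eq_of_balance (hF _) (neg_mem_signed (hG _)) h.1, abs_neg]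
      exact hGm 0
    | succ j =>
      exact (abs_le_of_balance (hF _) (hG _) (hG _) (h.2 j)).trans (max_le (hGm _) (hGm _))
  have hdom : ∀ i, abs (F.coeff i) = abs (G.coeff m) → i ∈ dominant F := by
    intro i hi
    rw [mem_dominant, hi]
    refine ⟨fun h0 => (mem_dominant.1 hm).1 ?_, hFle⟩
    rwa [← abs_eq_zero, ← hi, abs_eq_zero]
  -- At a sign change `l`, the coefficient of `G` in degree `l - 1` is either opposite to that in
  -- degree `l` or strictly smaller; both cases leave only the contribution of degree `l`.
  have hsc : ∀ l ∈ signChanges G, F.coeff l = neg (G.coeff l) ∧ l ∈ dominant G ∧ m < l := by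
    intro l hl
    obtain ⟨hl, k, hk, h1, h2⟩ := mem_signChanges.1 hl
    have hkd : k ∈ dominant G := mem_dominant_of_abs_eq hl (by rw [h1, abs_neg])
    refine ⟨?_, hl, (hm' k hkd).trans_lt hk⟩
    obtain ⟨j, rfl⟩ : ∃ j, l = j + 1 := ⟨l - 1, by omega⟩
    have hb := h.2 j
    rcases (Nat.lt_succ_iff.1 hk).eq_or_lt with rfl | hkj
    · rw [h1] at hb
      exact eq_neg_of_balance_of_eq_neg (hF _) (hG _) hb
    · exact eq_neg_of_balance (hF _) (hG _) (hG _) hb (h2 j hkj (by omega))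
  have hmS : m ∉ signChanges G := fun h => lt_irrefl m (hsc m h).2.2
  have htS : t + 1 ∉ insert m (signChanges G) := by
    rw [Finset.mem_insert]
    rintro (h | h)
    · have := hm' t ht; omega
    · have := ht' _ (hsc _ h).2.1; omega
  have hS : ∀ l ∈ insert m (signChanges G), F.coeff l = neg (G.coeff l) ∧ l ∈ dominant G := by
    intro l hl
    rcases Finset.mem_insert.1 hl with rfl | hl
    · exact ⟨hFm, hm⟩
    · exact ⟨(hsc l hl).1, (hsc l hl).2.1⟩
  have hconst : ∀ a ∈ dominant G, ∀ b ∈ dominant G, a ≤ b →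
      (∀ i ∈ signChanges G, ¬ (a < i ∧ i ≤ b)) → G.coeff a = G.coeff b := by
    intro a ha b hb hab hi
    rcases hab.eq_or_lt with rfl | hab
    · rfl
    refine eq_of_ne_neg (hG a) (hG b) (abs_eq_of_mem_dominant ha hb) fun hn => ?_
    obtain ⟨l, hl, h1⟩ := exists_mem_signChanges hG hab hb hn
    exact hi l hl h1
  -- The signs of `F` alternate along `m`, the sign changes of `G`, and `t + 1`. These are two more
  -- degrees than `G` has sign changes, so `F` has at least one sign change more than `G`.
  have := card_le_card_signChanges_add_one hF (insert (t + 1) (insert m (signChanges G))) ?_ ?_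
  · rw [Finset.card_insert_of_notMem htS, Finset.card_insert_of_notMem hmS] at this
    omega
  · intro d hd
    rcases Finset.mem_insert.1 hd with rfl | hd
    · exact hdom _ (by rw [hFt, abs_eq_of_mem_dominant ht hm])
    · exact hdom _ (by rw [(hS d hd).1, abs_neg, abs_eq_of_mem_dominant (hS d hd).2 hm])
  · intro a ha b hb hab hi
    have ha : a ∈ insert m (signChanges G) := by
      rcases Finset.mem_insert.1 ha with rfl | ha
      · rcases Finset.mem_insert.1 hb with rfl | hb
        · omega
        · have := ht' _ (hS _ hb).2; omega
      · exact ha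
    obtain ⟨hFa, had⟩ := hS a ha
    rw [hFa]
    rcases Finset.mem_insert.1 hb with rfl | hb
    · rw [hFt, hconst a had t ht (by omega) fun i hi' hlt =>
        hi i (by simp [hi']) ⟨hlt.1, by omega⟩]
    · rcases Finset.mem_insert.1 hb with rfl | hb
      · have := hm' a had; omega
      obtain ⟨hFb, hbd, -⟩ := hsc b hb
      obtain ⟨-, k, hk, h1, h2⟩ := mem_signChanges.1 hb
      have hkd : k ∈ dominant G := mem_dominant_of_abs_eq hbd (by rw [h1, abs_neg])
      have hak : a ≤ k := by
        by_contra hlt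
        exact absurd (abs_eq_of_mem_dominant had hbd) (h2 a (by omega) hab).ne
      rw [hFb, ← h1, hconst a had k hkd hak fun i hi' hlt =>
        hi i (by simp [hi']) ⟨hlt.1, by omega⟩]

/-! ### Division by Y ⊖ 1 -/

/-- Solution of `F ∇ (Y ⊖ 1) L`, constructed from the constant coefficient of `F` upwards. -/
def leftQuotient (F : (Smax Γ)[X]) : ℕ → Smax Γ
  | 0 => neg (F.coeff 0)
  | k + 1 => if abs (leftQuotient F k) ≤ abs (F.coeff (k + 1)) then neg (F.coeff (k + 1))
      else leftQuotient F k

theorem leftQuotient_mem_signed (hF : IsSignedPoly F) (k : ℕ) : leftQuotient F k ∈ signed Γ := by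
  induction k with
  | zero => exact neg_mem_signed (hF 0)
  | succ k ih =>
    rw [leftQuotient]
    split_ifs
    exacts [neg_mem_signed (hF _), ih]

theorem abs_leftQuotient_le {M : Tmax Γ} (hM : ∀ i, abs (F.coeff i) ≤ M) (k : ℕ) :
    abs (leftQuotient F k) ≤ M := by
  induction k with
  | zero => simpa [leftQuotient] using hM 0
  | succ k ih =>
    rw [leftQuotient]
    split_ifs
    · simpa using hM _
    · exact ih

theorem balance_leftQuotient (hF : IsSignedPoly F) (k : ℕ) :
    Balance (F.coeff (k + 1)) (leftQuotient F k + neg (leftQuotient F (k + 1))) := by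
  rw [leftQuotient]
  split_ifs with h
  · rw [neg_neg]
    exact balance_add_self (hF _) (leftQuotient_mem_signed hF k) h
  · exact balance_sub_self (hF _) (leftQuotient_mem_signed hF k) (not_le.1 h).le

/-- No earlier value exceeds a dominant coefficient, so the recursion resets there. -/
theorem leftQuotient_of_mem_dominant {l : ℕ} (hl : l ∈ dominant F) :
    leftQuotient F l = neg (F.coeff l) := by
  cases l with
  | zero => rfl
  | succ k =>
    rw [leftQuotient, if_pos (abs_leftQuotient_le (mem_dominant.1 hl).2 k)]

/-- The smaller coefficients after `k` never trigger a reset, so the value taken at `k` persists. -/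
theorem leftQuotient_of_between {k l : ℕ} (hk : k ∈ dominant F) (hkl : k ≤ l)
    (h : ∀ i, k < i → i ≤ l → abs (F.coeff i) < abs (F.coeff k)) :
    leftQuotient F l = neg (F.coeff k) := by
  induction l, hkl using Nat.le_induction with
  | base => exact leftQuotient_of_mem_dominant hk
  | succ l hkl ih =>
    have h1 := ih fun i hi hi' => h i hi (by omega)
    rw [leftQuotient, h1, abs_neg, if_neg (not_le.2 (h _ (by omega) le_rfl))]

/-- Solution of `F ∇ (Y ⊖ 1) R`, constructed from the leading coefficient of `F` downwards. -/
theorem exists_rightQuotient (n : ℕ) (f : ℕ → Smax Γ) (hf : ∀ k, f k ∈ signed Γ)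
    (hn : ∀ k, n < k → f k = 0) {M : Tmax Γ} (hM : ∀ k, abs (f k) ≤ M) :
    ∃ r : ℕ → Smax Γ, (∀ k, r k ∈ signed Γ) ∧ (∀ k, n ≤ k → r k = 0) ∧ (∀ k, abs (r k) ≤ M) ∧
      ∀ k, Balance (f (k + 1)) (r k + neg (r (k + 1))) := by
  induction n generalizing f with
  | zero =>
    refine ⟨fun _ => 0, fun _ => zero_mem_signed, fun _ _ => rfl, fun _ => by rw [map_zero]; exact zero_le,
      fun k => ?_⟩
    rw [hn (k + 1) (by omega), neg_zero, add_zero]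
    exact balance_refl (0 : Smax Γ)
  | succ n ih =>
    obtain ⟨r, h1, h2, h3, h4⟩ := ih (fun k => f (k + 1)) (fun k => hf _)
      (fun k hk => hn _ (by omega)) (fun k => hM _)
    -- The solution `r` for the shifted sequence is extended by a new constant coefficient: the one
    -- of `f 1` and `r 0` with larger modulus, and `f 1` in case of a tie.
    refine ⟨fun k => Nat.casesOn k (if abs (r 0) ≤ abs (f 1) then f 1 else r 0) r, ?_, ?_, ?_, ?_⟩
    · rintro (_ | k)
      · dsimp only
        split_ifs
        exacts [hf 1, h1 0]
      · exact h1 k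
    · rintro (_ | k) hk
      · omega
      · exact h2 k (by omega)
    · rintro (_ | k)
      · dsimp only
        split_ifs
        exacts [hM 1, h3 0]
      · exact h3 k
    · rintro (_ | k)
      · change Balance (f 1) ((if abs (r 0) ≤ abs (f 1) then f 1 else r 0) + neg (r 0))
        split_ifs with h
        · rw [add_comm]
          exact balance_add_self (hf _) (neg_mem_signed (h1 0)) (by rwa [abs_neg])
        · exact balance_sub_self (hf _) (h1 0) (not_le.1 h).le
      · exact h4 k

theorem exists_polynomial_coeff_eq (n : ℕ) (g : ℕ → Smax Γ) (hg : ∀ k, n ≤ k → g k = 0) :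
    ∃ G : (Smax Γ)[X], ∀ k, G.coeff k = g k := by
  refine ⟨∑ i ∈ Finset.range n, monomial i (g i), fun k => ?_⟩
  rw [finsetSum_coeff]
  simp only [coeff_monomial, Finset.sum_ite_eq', Finset.mem_range]
  split_ifs with h
  · rfl
  · exact (hg k (not_lt.1 h)).symm

/-- A factor `Y ⊖ 1` can be extracted with the loss of a single sign change. -/
theorem exists_isDifference (hF : IsSignedPoly F) (hne : (signChanges F).Nonempty) :
    ∃ G, IsSignedPoly G ∧ IsDifference F G ∧
      (signChanges F).card ≤ (signChanges G).card + 1 := by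
  have hb := (signChanges F).max'_mem hne
  have hmax : ∀ l ∈ signChanges F, l ≤ (signChanges F).max' hne := fun l hl =>
    Finset.le_max' _ _ hl
  set b := (signChanges F).max' hne
  obtain ⟨hbd, a, hab, hFab, hbtw⟩ := mem_signChanges.1 hb
  have hM := (mem_dominant.1 hbd).2
  obtain ⟨r, hr1, hr2, hr3, hr4⟩ := exists_rightQuotient F.natDegree F.coeff hF
    (fun k hk => coeff_eq_zero_of_natDegree_lt hk) hM
  have hbn : b ≤ F.natDegree := le_natDegree_of_ne_zero (mem_dominant.1 hbd).1
  -- The left solution is used below the last sign change `b`, the right solution from `b` on.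
  obtain ⟨G, hG⟩ := exists_polynomial_coeff_eq F.natDegree
    (fun k => if k < b then leftQuotient F k else r k) fun k hk => by
      rw [if_neg (by omega), hr2 k hk]
  have hGl : ∀ k < b, G.coeff k = leftQuotient F k := fun k hk => by rw [hG, if_pos hk]
  have hGr : ∀ k, b ≤ k → G.coeff k = r k := fun k hk => by rw [hG, if_neg (by omega)]
  have hpred : ∀ l k, l ∈ dominant F → k < l → F.coeff k = neg (F.coeff l) →
      (∀ i, k < i → i < l → abs (F.coeff i) < abs (F.coeff l)) →
      ∀ i, k ≤ i → i < l → leftQuotient F i = F.coeff l := by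
    intro l k hl hkl hk h i hi hi'
    rw [leftQuotient_of_between (k := k) (mem_dominant_of_abs_eq hl (by rw [hk, abs_neg])) hi, hk,
      neg_neg]
    intro j hj hj'
    rw [hk, abs_neg]
    exact h j hj (by omega)
  have hGM : ∀ i, abs (G.coeff i) ≤ abs (F.coeff b) := by
    intro i
    rw [hG]
    split_ifs
    exacts [abs_leftQuotient_le hM i, hr3 i]
  refine ⟨G, fun k => ?_, ⟨?_, fun k => ?_⟩, ?_⟩
  · rw [hG]
    split_ifs
    exacts [leftQuotient_mem_signed hF k, hr1 k]
  · rw [hGl 0 (by omega), leftQuotient, neg_neg]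
    exact balance_refl _
  · rcases lt_trichotomy (k + 1) b with h | h | h
    · rw [hGl _ h, hGl _ (by omega)]
      exact balance_leftQuotient hF k
    -- At the seam the left value is `F.coeff b` itself and the right value has no larger modulus,
    -- so the balance holds.
    · rw [hGl k (by omega), hGr _ h.ge, hpred b a hbd hab hFab hbtw k (by omega) (by omega),
        h, add_comm]
      exact balance_add_self (hF b) (neg_mem_signed (hr1 b)) (by rw [abs_neg]; exact hr3 b)
    · rw [hGr _ h.le, hGr _ (by omega)]
      exact hr4 k
  -- Every sign change `l` other than `b` lies below `b` and survives: `G` takes the values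
  -- ⊖`F.coeff l` in degree `l` and `F.coeff l` in degree `l - 1`.
  · rw [← Finset.card_erase_add_one hb]
    refine Nat.add_le_add_right (Finset.card_le_card fun l hl => ?_) 1
    obtain ⟨hlb, hl⟩ := Finset.mem_erase.1 hl
    have hlb : l < b := lt_of_le_of_ne (hmax l hl) hlb
    obtain ⟨hld, k, hkl, h1, h2⟩ := mem_signChanges.1 hl
    have hGll : G.coeff l = neg (F.coeff l) := by
      rw [hGl l hlb, leftQuotient_of_mem_dominant hld]
    rw [mem_signChanges, mem_dominant, hGll, neg_neg, abs_neg]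
    refine ⟨⟨fun h0 => (mem_dominant.1 hld).1 (neg_eq_zero.1 h0), fun i => ?_⟩,
      l - 1, by omega, ?_, fun i hi hi' => by omega⟩
    · rw [abs_eq_of_mem_dominant hld hbd]
      exact hGM i
    · rw [hGl _ (by omega), hpred l k hld hkl h1 h2 (l - 1) (by omega) (by omega)]

end Smax

/-! ### Multiplicities of roots -/

namespace Smax

open Polynomial

variable {Γ : Type*} [AddCommGroup Γ] [LinearOrder Γ] [IsOrderedAddMonoid Γ]

/-- The polynomial `P(a Y)`. -/
def rescale (a : Smax Γ) (P : (Smax Γ)[X]) : (Smax Γ)[X] := P.comp (C a * X)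

variable {a : Smax Γ} {P Q F G : (Smax Γ)[X]}

@[simp] theorem coeff_rescale (a : Smax Γ) (P : (Smax Γ)[X]) (k : ℕ) :
    (rescale a P).coeff k = P.coeff k * a ^ k := comp_C_mul_X_coeff

theorem isSignedPoly_rescale (ha : a ∈ signed Γ) (hP : IsSignedPoly P) :
    IsSignedPoly (rescale a P) := fun k => by
  rw [coeff_rescale]
  exact mul_mem_signed (hP k) (pow_mem_signed ha k)

theorem coeff_rescale_eq_zero (h0 : a ≠ 0) {k : ℕ} :
    (rescale a P).coeff k = 0 ↔ P.coeff k = 0 := by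
  rw [coeff_rescale]
  refine ⟨fun h => ?_, fun h => by rw [h, zero_mul]⟩
  by_contra hk
  exact mul_ne_zero' hk (pow_ne_zero' h0 k) h

theorem isSignedPoly_C_mul {t : Smax Γ} (ht : t ∈ signed Γ) (hP : IsSignedPoly P) :
    IsSignedPoly (C t * P) := fun k => by
  rw [coeff_C_mul]
  exact mul_mem_signed ht (hP k)

theorem dominant_C_mul {t : Smax Γ} (h0 : t ≠ 0) (F : (Smax Γ)[X]) :
    dominant (C t * F) = dominant F := by
  ext l
  have ht : 0 < abs t := zero_lt_iff.2 (by simpa using h0)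
  simp only [mem_dominant, coeff_C_mul, map_mul, mul_le_mul_iff_right₀ ht]
  refine and_congr_left fun _ => not_congr ⟨fun h => ?_, fun h => by rw [h, mul_zero]⟩
  by_contra hl
  exact mul_ne_zero' h0 hl h

theorem signChanges_C_mul {t : Smax Γ} (ht : t ∈ signed Γ) (h0 : t ≠ 0) (F : (Smax Γ)[X]) :
    signChanges (C t * F) = signChanges F := by
  ext l
  have ht' : 0 < abs t := zero_lt_iff.2 (by simpa using h0)
  simp only [mem_signChanges, dominant_C_mul h0, coeff_C_mul, map_mul, ← mul_neg,
    mul_left_inj_signed ht h0, mul_lt_mul_iff_right₀ ht']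

/-- The value P(a) is the sum of the coefficients of P(aY), so it balances zero iff dominant
coefficients of both signs occur. -/
theorem isRootOf_iff_signChanges_nonempty (ha : a ∈ signed Γ) (h0 : a ≠ 0)
    (hP : IsSignedPoly P) (hP0 : P ≠ 0) :
    IsRootOf a P ↔ (signChanges (rescale a P)).Nonempty := by
  have hF := isSignedPoly_rescale ha hP
  rw [IsRootOf, eval_eq_sum, Polynomial.sum, balance_sum_zero_iff]
  · simp only [← coeff_rescale]
    constructor
    · rintro ⟨i, hi, j, hj, hij, hmax⟩
      have hid : i ∈ dominant (rescale a P) := by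
        rw [mem_dominant, Ne, coeff_rescale_eq_zero h0]
        refine ⟨mem_support_iff.1 hi, fun k => ?_⟩
        by_cases hk : P.coeff k = 0
        · rw [(coeff_rescale_eq_zero h0).2 hk, map_zero]
          exact zero_le
        · exact hmax k (mem_support_iff.2 hk)
      have hjd : j ∈ dominant (rescale a P) :=
        mem_dominant_of_abs_eq hid (by rw [hij, abs_neg])
      rcases lt_trichotomy i j with h | rfl | h
      · obtain ⟨l, hl, -⟩ := exists_mem_signChanges hF h hjd hij
        exact ⟨l, hl⟩
      · exact absurd hij (ne_neg_self (hF i) (mem_dominant.1 hid).1)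
      · obtain ⟨l, hl, -⟩ := exists_mem_signChanges hF h hid (eq_neg_comm.1 hij)
        exact ⟨l, hl⟩
    · rintro ⟨l, hl⟩
      obtain ⟨hl, k, -, hkl, -⟩ := mem_signChanges.1 hl
      have hl0 := (mem_dominant.1 hl).1
      have hk0 : (rescale a P).coeff k ≠ 0 := by rwa [hkl, Ne, neg_eq_zero]
      rw [Ne, coeff_rescale_eq_zero h0] at hl0 hk0
      exact ⟨l, mem_support_iff.2 hl0, k, mem_support_iff.2 hk0, eq_neg_comm.1 hkl,
        fun i _ => (mem_dominant.1 hl).2 i⟩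
  · intro i _
    exact mul_mem_signed (hP i) (pow_mem_signed ha i)
  · obtain ⟨i, hi⟩ := support_nonempty.2 hP0
    exact ⟨i, hi, mul_ne_zero' (mem_support_iff.1 hi) (pow_ne_zero' h0 i)⟩

theorem isQuotientBy_iff : IsQuotientBy a P Q ↔ IsSignedPoly Q ∧ ∃ t ∈ signed Γ, t ≠ 0 ∧
    Balance (t * P.coeff 0) (neg (a * Q.coeff 0)) ∧
      ∀ k, Balance (t * P.coeff (k + 1)) (Q.coeff k + neg (a * Q.coeff (k + 1))) := by
  have hc0 : ((X + C (neg a)) * Q).coeff 0 = neg (a * Q.coeff 0) := by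
    simp [add_mul, neg_mul]
  have hc : ∀ k, ((X + C (neg a)) * Q).coeff (k + 1) = Q.coeff k + neg (a * Q.coeff (k + 1)) := by
    simp [add_mul, neg_mul]
  refine and_congr_right fun _ => exists_congr fun t => and_congr_right fun _ =>
    and_congr_right fun _ => ⟨fun h => ⟨?_, fun k => ?_⟩, fun h k => ?_⟩
  · have := h 0
    rwa [coeff_C_mul, hc0] at this
  · have := h (k + 1)
    rwa [coeff_C_mul, hc] at this
  · rw [coeff_C_mul]
    cases k with
    | zero => rw [hc0]; exact h.1
    | succ k => rw [hc]; exact h.2 k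

theorem IsQuotientBy.ne_zero (hP : IsSignedPoly P) (hP0 : P ≠ 0) (h : IsQuotientBy a P Q) :
    Q ≠ 0 := by
  rintro rfl
  obtain ⟨-, t, ht, ht0, h1, h2⟩ := isQuotientBy_iff.1 h
  refine hP0 (Polynomial.ext fun k => ?_)
  by_contra hk
  refine mul_ne_zero' ht0 hk (eq_of_balance (mul_mem_signed ht (hP k)) zero_mem_signed ?_)
  cases k with
  | zero => simpa using h1
  | succ k => simpa using h2 k

/-- Substituting aY turns (Y ⊖ a)Q into (Y ⊖ 1) times aQ(aY), which reduces the claim to the root 1.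
Non-zero signed scalars do not affect sign changes. -/
theorem IsQuotientBy.card_signChanges_lt (ha : a ∈ signed Γ) (h0 : a ≠ 0)
    (hP : IsSignedPoly P) (hP0 : P ≠ 0) (h : IsQuotientBy a P Q) :
    (signChanges (rescale a Q)).card + 1 ≤ (signChanges (rescale a P)).card := by
  have hQ0 := h.ne_zero hP hP0
  obtain ⟨hQ, t, ht, ht0, h1, h2⟩ := isQuotientBy_iff.1 h
  rw [← signChanges_C_mul ht ht0 (rescale a P), ← signChanges_C_mul ha h0 (rescale a Q)]
  refine IsDifference.card_signChanges_lt (isSignedPoly_C_mul ht (isSignedPoly_rescale ha hP))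
    (isSignedPoly_C_mul ha (isSignedPoly_rescale ha hQ)) (fun hz => hQ0 ?_) ⟨?_, fun k => ?_⟩
  · ext k
    have := congrArg (coeff · k) hz
    rw [coeff_C_mul, coeff_rescale, coeff_zero] at this
    by_contra hk
    exact mul_ne_zero' h0 (mul_ne_zero' hk (pow_ne_zero' h0 k)) this
  · simpa using h1
  · have := balance_mul_left (a ^ (k + 1)) (h2 k)
    simp only [coeff_C_mul, coeff_rescale]
    rw [_root_.mul_add, mul_neg] at this
    convert this using 1
    · ring
    · congr 1
      · ring
      · congr 1; ring

/-- With b the inverse of a, a quotient G of P(aY) by Y ⊖ 1 gives the quotient bG(bY) of P by Y ⊖ a.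
-/
theorem exists_isQuotientBy (ha : a ∈ signed Γ) (h0 : a ≠ 0) (hP : IsSignedPoly P)
    (hne : (signChanges (rescale a P)).Nonempty) :
    ∃ Q, IsQuotientBy a P Q ∧
      (signChanges (rescale a P)).card ≤ (signChanges (rescale a Q)).card + 1 := by
  obtain ⟨G, hG, ⟨hd0, hd⟩, hcard⟩ := exists_isDifference (isSignedPoly_rescale ha hP) hne
  obtain ⟨b, hb, hb0, hab⟩ := exists_inv ha h0
  have hpow : ∀ k, a ^ k * b ^ k = 1 := fun k => by rw [← mul_pow, hab, one_pow]
  have hQ : rescale a (C b * rescale b G) = C b * G := by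
    ext k
    simp only [coeff_C_mul, coeff_rescale]
    rw [mul_assoc, mul_assoc, mul_comm (b ^ k), hpow, mul_one]
  refine ⟨C b * rescale b G, isQuotientBy_iff.2
    ⟨isSignedPoly_C_mul hb (isSignedPoly_rescale hb hG), 1, one_mem_signed, ?_, ?_, fun k => ?_⟩, ?_⟩
  · exact ofTmax_ne_zero one_ne_zero
  · simpa [← mul_assoc, hab] using hd0
  · have := balance_mul_left (b ^ (k + 1)) (hd k)
    simp only [coeff_C_mul, coeff_rescale]
    rw [_root_.mul_add, mul_neg, coeff_rescale] at this
    convert this using 1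
    · rw [one_mul, mul_left_comm, mul_comm (b ^ (k + 1)), hpow, mul_one]
    · congr 1
      · ring
      · congr 1
        rw [← mul_assoc, hab, one_mul, mul_comm]
  · rwa [hQ, signChanges_C_mul hb hb0]

/-- Every quotient loses at least one sign change and some quotient loses just one, so the recursion
for multiplicities counts sign changes. -/
theorem multGE_iff_le_card (ha : a ∈ signed Γ) (h0 : a ≠ 0) (hP : IsSignedPoly P) (hP0 : P ≠ 0)
    (m : ℕ) : MultGE a m P ↔ m ≤ (signChanges (rescale a P)).card := by
  induction m generalizing P with
  | zero => simp [MultGE]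
  | succ m ih =>
    rw [MultGE, isRootOf_iff_signChanges_nonempty ha h0 hP hP0, ← Finset.card_pos]
    constructor
    · rintro ⟨hpos, rfl | ⟨Q, hQ, hm⟩⟩
      · exact hpos
      · rw [ih hQ.1 (hQ.ne_zero hP hP0)] at hm
        have := hQ.card_signChanges_lt ha h0 hP hP0
        omega
    · intro h
      have hpos : 0 < (signChanges (rescale a P)).card := by omega
      obtain ⟨Q, hQ, hcard⟩ := exists_isQuotientBy ha h0 hP (Finset.card_pos.1 hpos)
      exact ⟨hpos, Or.inr ⟨Q, hQ, (ih hQ.1 (hQ.ne_zero hP hP0)).2 (by omega)⟩⟩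

theorem mult_eq_of_multGE_iff {N : ℕ} (h : ∀ m, MultGE a m P ↔ m ≤ N) : mult a P = N :=
  le_antisymm (iSup₂_le fun m hm => by exact_mod_cast (h m).1 hm)
    (le_iSup₂_of_le (f := fun (m : ℕ) (_ : MultGE a m P) => (m : ℕ∞)) N ((h N).2 le_rfl) le_rfl)

/-- The multiplicity of a non-zero root is the number of sign changes of the saturation
polynomial. -/
theorem mult_eq_card_signChanges (ha : a ∈ signed Γ) (h0 : a ≠ 0) (hP : IsSignedPoly P)
    (hP0 : P ≠ 0) : mult a P = (signChanges (rescale a P)).card :=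
  mult_eq_of_multGE_iff (multGE_iff_le_card ha h0 hP hP0)

/-! ### The root zero -/

theorem isRootOf_zero_iff (hP : IsSignedPoly P) : IsRootOf (0 : Smax Γ) P ↔ P.coeff 0 = 0 := by
  rw [IsRootOf, ← coeff_zero_eq_eval_zero]
  exact ⟨eq_of_balance (hP 0) zero_mem_signed, fun h => h ▸ balance_refl _⟩

/-- A balance of λP with YQ is an equality, since all coefficients are signed; dividing by Y is then
a shift, up to a unit. -/
theorem multGE_zero_iff (hP : IsSignedPoly P) (m : ℕ) :
    MultGE (0 : Smax Γ) m P ↔ ∀ i < m, P.coeff i = 0 := by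
  induction m generalizing P with
  | zero => simp [MultGE]
  | succ m ih =>
    rw [MultGE, isRootOf_zero_iff hP]
    constructor
    · rintro ⟨hr, rfl | ⟨Q, hQ, hm⟩⟩ i hi
      · rwa [Nat.lt_one_iff.1 hi]
      · rw [ih hQ.1] at hm
        obtain ⟨hQs, t, ht, ht0, -, h2⟩ := isQuotientBy_iff.1 hQ
        cases i with
        | zero => exact hr
        | succ i =>
          have := h2 i
          rw [hm i (by omega), zero_mul, neg_zero, add_zero] at this
          by_contra hne
          exact mul_ne_zero' ht0 hne
            (eq_of_balance (mul_mem_signed ht (hP _)) zero_mem_signed this)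
    · intro h
      have hQ : IsSignedPoly P.divX := fun k => by rw [coeff_divX]; exact hP _
      refine ⟨h 0 (by omega), Or.inr ⟨P.divX, isQuotientBy_iff.2 ⟨hQ, 1, one_mem_signed,
        ofTmax_ne_zero one_ne_zero, ?_, fun k => ?_⟩, (ih hQ).2 fun i hi => ?_⟩⟩
      · rw [h 0 (by omega), zero_mul, mul_zero, neg_zero]
        exact balance_refl _
      · rw [zero_mul, neg_zero, add_zero, one_mul, coeff_divX]
        exact balance_refl _
      · rw [coeff_divX]
        exact h _ (by omega)

theorem mult_zero_eq (hP : IsSignedPoly P) (hP0 : P ≠ 0) : mult (0 : Smax Γ) P = P.natTrailingDegree := by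
  refine mult_eq_of_multGE_iff fun m => ?_
  rw [multGE_zero_iff hP]
  constructor
  · intro h
    by_contra hlt
    exact hP0 (trailingCoeff_eq_zero.1 (h _ (not_le.1 hlt)))
  · exact fun h i hi => coeff_eq_zero_of_lt_natTrailingDegree (by omega)

end Smax

/-! ### Slopes of the Newton polygon -/

namespace Tmax

variable {Γ : Type*} [AddCommGroup Γ] [LinearOrder Γ] [IsOrderedAddMonoid Γ]

/-- Extracting a root in `Tmax Γ` is dividing in Γ; this is what divisibility provides. -/
theorem exists_pow_eq (hdiv : ∀ m : ℕ, 0 < m → ∀ a : Γ, ∃ b : Γ, m • b = a) {m : ℕ} (hm : 0 < m)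
    {x : Tmax Γ} (hx : x ≠ 0) : ∃ y : Tmax Γ, y ≠ 0 ∧ y ^ m = x := by
  obtain ⟨g, rfl⟩ := WithZero.ne_zero_iff_exists.1 hx
  obtain ⟨b, hb⟩ := hdiv m hm g.toAdd
  refine ⟨((Multiplicative.ofAdd b : Multiplicative Γ) : WithZero (Multiplicative Γ)),
    WithZero.coe_ne_zero, ?_⟩
  refine (WithZero.coe_pow _ _).symm.trans ?_
  rw [← ofAdd_nsmul, hb]
  rfl

theorem mul_pow_le_mul_pow_iff {w w' c : Tmax Γ} (hc : c ≠ 0) {i j : ℕ} (hij : i ≤ j) :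
    w * c ^ i ≤ w' * c ^ j ↔ w ≤ w' * c ^ (j - i) := by
  have : w' * c ^ j = w' * c ^ (j - i) * c ^ i := by
    rw [mul_assoc, ← pow_add, Nat.sub_add_cancel hij]
  rw [this, mul_le_mul_iff_left₀ (zero_lt_iff.2 (pow_ne_zero i hc))]

theorem mul_pow_le_mul_pow_iff' {w w' c : Tmax Γ} (hc : c ≠ 0) {i j : ℕ} (hij : i ≤ j) :
    w' * c ^ j ≤ w * c ^ i ↔ w' * c ^ (j - i) ≤ w := by
  have : w' * c ^ j = w' * c ^ (j - i) * c ^ i := by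
    rw [mul_assoc, ← pow_add, Nat.sub_add_cancel hij]
  rw [this, mul_le_mul_iff_left₀ (zero_lt_iff.2 (pow_ne_zero i hc))]

/-- The monomial of larger degree dominates for large arguments. -/
theorem le_of_monomial_le {w w' c c' : Tmax Γ} (hc : c ≠ 0) (hc' : c' ≠ 0) (hw' : w' ≠ 0)
    {i j : ℕ} (hij : i < j) (h : w * c ^ i ≤ w' * c ^ j) (h' : w' * c' ^ j ≤ w * c' ^ i) :
    c' ≤ c := by
  rw [mul_pow_le_mul_pow_iff hc hij.le] at h
  rw [mul_pow_le_mul_pow_iff' hc' hij.le] at h'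
  exact le_of_pow_le_pow_left₀ (by omega) zero_le
    ((mul_le_mul_iff_right₀ (zero_lt_iff.2 hw')).1 (h'.trans h))

/-- At every step of the degree there is a slope of the Newton polygon. -/
theorem exists_slope (hdiv : ∀ m : ℕ, 0 < m → ∀ a : Γ, ∃ b : Γ, m • b = a) (w : ℕ → Tmax Γ)
    {v l n : ℕ} (hv : w v ≠ 0) (hn : w n ≠ 0) (hvl : v < l) (hln : l ≤ n)
    (hw : ∀ k, n < k → w k = 0) :
    ∃ c : Tmax Γ, c ≠ 0 ∧ ∃ i j, i < l ∧ l ≤ j ∧ w i ≠ 0 ∧ w j ≠ 0 ∧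
      (∀ k, w k * c ^ k ≤ w i * c ^ i) ∧ ∀ k, w k * c ^ k ≤ w j * c ^ j := by
  classical
  -- At the argument `s i j` the monomials `i` and `j` agree. The value 0 for irrelevant pairs is
  -- never used.
  have hs : ∀ i j, ∃ s : Tmax Γ, i < l → l ≤ j → w i ≠ 0 → w j ≠ 0 →
      s ≠ 0 ∧ w j * s ^ j = w i * s ^ i := by
    intro i j
    by_cases h : i < l ∧ l ≤ j ∧ w i ≠ 0 ∧ w j ≠ 0
    · obtain ⟨hi, hj, hwi, hwj⟩ := h
      obtain ⟨s, hs0, hs⟩ := exists_pow_eq hdiv (m := j - i) (by omega) (div_ne_zero hwi hwj)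
      refine ⟨s, fun _ _ _ _ => ⟨hs0, ?_⟩⟩
      rw [← Nat.sub_add_cancel (show i ≤ j by omega), pow_add, ← mul_assoc,
        Nat.sub_add_cancel (show i ≤ j by omega), hs, mul_div_cancel₀ _ hwj]
    · exact ⟨0, fun h1 h2 h3 h4 => absurd ⟨h1, h2, h3, h4⟩ h⟩
  choose s hs using hs
  let I := (Finset.range l).filter fun i => w i ≠ 0
  let J := (Finset.Icc l n).filter fun j => w j ≠ 0
  have hI : ∀ i, i ∈ I ↔ i < l ∧ w i ≠ 0 := fun i => by simp [I]
  have hJ : ∀ j, j ∈ J ↔ l ≤ j ∧ w j ≠ 0 := fun j => by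
    simp only [J, Finset.mem_filter, Finset.mem_Icc]
    refine ⟨fun h => ⟨h.1.1, h.2⟩, fun h => ⟨⟨h.1, ?_⟩, h.2⟩⟩
    by_contra hlt
    exact h.2 (hw j (not_le.1 hlt))
  -- The required slope is a max-min: the least slope from `i` to a degree in `J`, maximised over
  -- `i` in `I`.
  have hmin : ∀ i, ∃ j ∈ J, ∀ k ∈ J, s i j ≤ s i k := fun i =>
    J.exists_min_image (s i) ⟨n, (hJ n).2 ⟨hln, hn⟩⟩
  choose j hjJ hjmin using hmin
  obtain ⟨i, hiI, himax⟩ := I.exists_max_image (fun i => s i (j i)) ⟨v, (hI v).2 ⟨hvl, hv⟩⟩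
  have hmem : ∀ i ∈ I, ∀ j ∈ J, s i j ≠ 0 ∧ w j * s i j ^ j = w i * s i j ^ i := fun i hi j hj =>
    hs i j ((hI i).1 hi).1 ((hJ j).1 hj).1 ((hI i).1 hi).2 ((hJ j).1 hj).2
  obtain ⟨hc, hceq⟩ := hmem i hiI (j i) (hjJ i)
  set c := s i (j i)
  -- Since `c ≤ s i k`, the monomial `k` has not yet overtaken `i` at `c`.
  have hJi : ∀ k ∈ J, w k * c ^ k ≤ w i * c ^ i := by
    intro k hk
    obtain ⟨h0, heq⟩ := hmem i hiI k hk
    have hik : i < k := ((hI i).1 hiI).1.trans_le ((hJ k).1 hk).1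
    rw [mul_pow_le_mul_pow_iff' hc hik.le]
    refine le_trans ?_ ((mul_pow_le_mul_pow_iff' h0 hik.le).1 heq.le)
    gcongr
    exact hjmin i k hk
  -- Since `s k (j k) ≤ c`, the monomial `j k` has caught up with `k` at `c`, and it is itself
  -- bounded by the monomial `i`.
  have hIj : ∀ k ∈ I, w k * c ^ k ≤ w i * c ^ i := by
    intro k hk
    refine le_trans ?_ (hJi (j k) (hjJ k))
    obtain ⟨h0, heq⟩ := hmem k hk (j k) (hjJ k)
    have hik : k < j k := ((hI k).1 hk).1.trans_le ((hJ _).1 (hjJ k)).1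
    rw [mul_pow_le_mul_pow_iff hc hik.le]
    refine ((mul_pow_le_mul_pow_iff h0 hik.le).1 heq.ge).trans ?_
    gcongr
    exact himax k hk
  have hall : ∀ k, w k * c ^ k ≤ w i * c ^ i := by
    intro k
    by_cases hk : w k = 0
    · rw [hk, zero_mul]
      exact zero_le
    · rcases lt_or_ge k l with hkl | hkl
      · exact hIj k ((hI k).2 ⟨hkl, hk⟩)
      · exact hJi k ((hJ k).2 ⟨hkl, hk⟩)
  exact ⟨c, hc, i, j i, ((hI i).1 hiI).1, ((hJ _).1 (hjJ i)).1, ((hI i).1 hiI).2,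
    ((hJ _).1 (hjJ i)).2, hall, fun k => hceq ▸ hall k⟩

end Tmax

/-! ### Counting sign changes at a corner -/

namespace Smax

open Polynomial

variable {Γ : Type*} [AddCommGroup Γ] [LinearOrder Γ] [IsOrderedAddMonoid Γ]
variable {P F : (Smax Γ)[X]}

/-- The degrees `l` lying between two dominant degrees of `F`, in the sense `i < l ≤ j`. -/
def dominantSteps (F : (Smax Γ)[X]) : Finset ℕ :=
  (dominant F ×ˢ dominant F).biUnion fun x => Finset.Ioc x.1 x.2

theorem mem_dominantSteps {l : ℕ} :
    l ∈ dominantSteps F ↔ ∃ i ∈ dominant F, ∃ j ∈ dominant F, i < l ∧ l ≤ j := by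
  simp only [dominantSteps, Finset.mem_biUnion, Finset.mem_product, Finset.mem_Ioc, Prod.exists]
  grind

/-- `k < l` are successive dominant degrees of `F`. -/
def DominantSuccessive (F : (Smax Γ)[X]) (k l : ℕ) : Prop :=
  k < l ∧ k ∈ dominant F ∧ l ∈ dominant F ∧ ∀ i, k < i → i < l → i ∉ dominant F

theorem exists_dominantSuccessive {l : ℕ} (hl : l ∈ dominantSteps F) :
    ∃ k m, DominantSuccessive F k m ∧ k < l ∧ l ≤ m := by
  obtain ⟨i, hi, j, hj, hil, hlj⟩ := mem_dominantSteps.1 hl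
  have h1 : ((dominant F).filter (· < l)).Nonempty := ⟨i, by simp [hi, hil]⟩
  have h2 : ((dominant F).filter (l ≤ ·)).Nonempty := ⟨j, by simp [hj, hlj]⟩
  have hk := Finset.mem_filter.1 (Finset.max'_mem _ h1)
  have hm := Finset.mem_filter.1 (Finset.min'_mem _ h2)
  refine ⟨_, _, ⟨hk.2.trans_le hm.2, hk.1, hm.1, fun x hx hx' hxd => ?_⟩, hk.2, hm.2⟩
  rcases lt_or_ge x l with h | h
  · exact absurd (Finset.le_max' _ x (Finset.mem_filter.2 ⟨hxd, h⟩)) (not_le.2 hx)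
  · exact absurd (Finset.min'_le _ x (Finset.mem_filter.2 ⟨hxd, h⟩)) (not_le.2 hx')

theorem DominantSuccessive.right_mem_dominantSteps {k l : ℕ} (h : DominantSuccessive F k l) :
    l ∈ dominantSteps F :=
  mem_dominantSteps.2 ⟨k, h.2.1, l, h.2.2.1, h.1, le_rfl⟩

theorem exists_dominantSuccessive_left {l : ℕ} (hl : l ∈ dominantSteps F) (hd : l ∈ dominant F) :
    ∃ k, DominantSuccessive F k l := by
  obtain ⟨k, m, h, hkl, hlm⟩ := exists_dominantSuccessive hl
  rcases hlm.eq_or_lt with rfl | hlm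
  · exact ⟨k, h⟩
  · exact absurd hd (h.2.2.2 l hkl hlm)

theorem DominantSuccessive.mem_signChanges_iff {k l : ℕ} (h : DominantSuccessive F k l) :
    l ∈ signChanges F ↔ F.coeff k = neg (F.coeff l) :=
  mem_signChanges_iff_of_successive h.2.1 h.2.2.1 h.1 h.2.2.2

theorem signChanges_subset_dominantSteps : signChanges F ⊆ dominantSteps F := fun l hl => by
  obtain ⟨hl, k, hkl, h, -⟩ := mem_signChanges.1 hl
  exact mem_dominantSteps.2
    ⟨k, mem_dominant_of_abs_eq hl (by rw [h, abs_neg]), l, hl, hkl, le_rfl⟩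

theorem neg_one_mem_signed : neg (1 : Smax Γ) ∈ signed Γ := neg_mem_signed one_mem_signed

theorem neg_one_ne_zero : neg (1 : Smax Γ) ≠ 0 := fun h =>
  ofTmax_ne_zero (one_ne_zero (α := Tmax Γ)) (neg_eq_zero.1 h)

theorem dominant_rescale_neg_one (F : (Smax Γ)[X]) :
    dominant (rescale (neg 1) F) = dominant F := by
  ext l
  simp [mem_dominant, coeff_rescale_eq_zero neg_one_ne_zero, -coeff_rescale]
  simp

theorem dominantSteps_rescale_neg_one (F : (Smax Γ)[X]) :
    dominantSteps (rescale (neg 1) F) = dominantSteps F := by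
  rw [dominantSteps, dominant_rescale_neg_one, dominantSteps]

theorem neg_one_mul_neg_one : neg (1 : Smax Γ) * neg 1 = 1 := by
  rw [← neg_eq_mul, neg_neg]

/-- The common invertible factor (⊖1)^k cancels, so only the parity of `l - k` matters. -/
theorem DominantSuccessive.mem_signChanges_rescale_iff {k l : ℕ}
    (h : DominantSuccessive F k l) :
    l ∈ signChanges (rescale (neg 1) F) ↔ F.coeff k = neg (F.coeff l * neg 1 ^ (l - k)) := by
  have h' : DominantSuccessive (rescale (neg 1) F) k l := by
    rwa [DominantSuccessive, dominant_rescale_neg_one]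
  rw [h'.mem_signChanges_iff, coeff_rescale, coeff_rescale]
  nth_rw 2 [← Nat.sub_add_cancel h.1.le]
  rw [pow_add, ← mul_left_inj_signed (pow_mem_signed neg_one_mem_signed k)
    (pow_ne_zero' neg_one_ne_zero k) (x := F.coeff k), mul_neg]
  refine iff_of_eq (congrArg₂ _ (mul_comm _ _) (congrArg neg ?_))
  ring

open Classical in
/-- The positive and the negative sign changes, together with the predecessors of the degrees that
are both. -/
def signChangeSteps (F : (Smax Γ)[X]) : Finset ℕ :=
  (signChanges F ∪ signChanges (rescale (neg 1) F)) ∪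
    (signChanges F ∩ signChanges (rescale (neg 1) F)).image (· - 1)

/-- For adjacent degrees F(⊖Y) reverses the relative sign, so two sign changes would make a non-zero
signed coefficient its own opposite. -/
theorem not_mem_signChanges_both {k : ℕ} (hF : IsSignedPoly F)
    (h : DominantSuccessive F k (k + 1)) (h1 : k + 1 ∈ signChanges F)
    (h2 : k + 1 ∈ signChanges (rescale (neg 1) F)) : False := by
  rw [h.mem_signChanges_iff] at h1
  rw [h.mem_signChanges_rescale_iff, Nat.add_sub_cancel_left, pow_one, mul_neg, mul_one, neg_neg,
    h1, eq_comm] at h2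
  exact ne_neg_self (hF _) (mem_dominant.1 h.2.2.1).1 h2

theorem exists_successive_of_mem_both {l : ℕ} (hF : IsSignedPoly F) (h1 : l ∈ signChanges F)
    (h2 : l ∈ signChanges (rescale (neg 1) F)) : ∃ k, DominantSuccessive F k l ∧ k + 2 ≤ l := by
  obtain ⟨k, hk⟩ := exists_dominantSuccessive_left (signChanges_subset_dominantSteps h1)
    (mem_signChanges.1 h1).1
  refine ⟨k, hk, ?_⟩
  by_contra hlt
  have := hk.1
  obtain rfl : l = k + 1 := by omega
  exact not_mem_signChanges_both hF hk h1 h2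

theorem signChangeSteps_subset (hF : IsSignedPoly F) : signChangeSteps F ⊆ dominantSteps F := by
  intro l hl
  simp only [signChangeSteps, Finset.mem_union, Finset.mem_image, Finset.mem_inter] at hl
  rcases hl with (hl | hl) | ⟨m, ⟨h1, h2⟩, rfl⟩
  · exact signChanges_subset_dominantSteps hl
  · rw [← dominantSteps_rescale_neg_one]
    exact signChanges_subset_dominantSteps hl
  · obtain ⟨k, hk, hkm⟩ := exists_successive_of_mem_both hF h1 h2
    exact mem_dominantSteps.2 ⟨k, hk.2.1, m, hk.2.2.1, by omega, by omega⟩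

/-- A degree counted for both signs lies at least 2 above the preceding dominant degree. Its
predecessor is therefore not dominant and has not been counted before; the bound also makes
truncated subtraction injective here. -/
theorem card_signChangeSteps (hF : IsSignedPoly F) : (signChangeSteps F).card =
    (signChanges F).card + (signChanges (rescale (neg 1) F)).card := by
  classical
  rw [signChangeSteps, Finset.card_union_of_disjoint, Finset.card_image_of_injOn]
  · convert Finset.card_union_add_card_inter _ _
  · intro l hl m hm hlm
    simp only [Finset.coe_inter, Set.mem_inter_iff, Finset.mem_coe] at hl hm
    obtain ⟨k, -, hk⟩ := exists_successive_of_mem_both hF hl.1 hl.2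
    obtain ⟨k', -, hk'⟩ := exists_successive_of_mem_both hF hm.1 hm.2
    simp only at hlm
    omega
  · rw [Finset.disjoint_right]
    intro l hl hl'
    obtain ⟨m, hm, rfl⟩ := Finset.mem_image.1 hl
    rw [Finset.mem_inter] at hm
    obtain ⟨k, hk, hkm⟩ := exists_successive_of_mem_both hF hm.1 hm.2
    refine hk.2.2.2 (m - 1) (by omega) (by omega) ?_
    rcases Finset.mem_union.1 hl' with h | h
    · exact (mem_signChanges.1 h).1
    · rw [← dominant_rescale_neg_one]
      exact (mem_signChanges.1 h).1

theorem card_add_card_signChanges_le (hF : IsSignedPoly F) :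
    (signChanges F).card + (signChanges (rescale (neg 1) F)).card ≤ (dominantSteps F).card := by
  rw [← card_signChangeSteps hF]
  exact Finset.card_le_card (signChangeSteps_subset hF)

/-- In the block (k, l] only `l` and `l - 1` can be counted, the latter only if both signs change at
`l`. So the block is filled only in the two listed cases. -/
theorem card_add_card_signChanges_eq_iff (hF : IsSignedPoly F) :
    (signChanges F).card + (signChanges (rescale (neg 1) F)).card = (dominantSteps F).card ↔
      ∀ k l, DominantSuccessive F k l →
        l - k = 1 ∨ (l - k = 2 ∧ F.coeff l = neg (F.coeff k)) := by
  classical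
  have hmem : ∀ l, l ∈ signChangeSteps F ↔ (l ∈ signChanges F ∨
      l ∈ signChanges (rescale (neg 1) F)) ∨
      ∃ m, (m ∈ signChanges F ∧ m ∈ signChanges (rescale (neg 1) F)) ∧ m - 1 = l := by
    simp [signChangeSteps, or_assoc]
  have hdom : ∀ l, (l ∈ signChanges F ∨ l ∈ signChanges (rescale (neg 1) F)) →
      l ∈ dominant F := by
    rintro l (h | h)
    · exact (mem_signChanges.1 h).1
    · rw [← dominant_rescale_neg_one]
      exact (mem_signChanges.1 h).1
  rw [← card_signChangeSteps hF]
  constructor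
  · intro heq k l h
    have hS := Finset.eq_of_subset_of_card_le (signChangeSteps_subset hF) heq.ge
    by_cases h1 : l - k = 1
    · exact Or.inl h1
    have hkl := h.1
    -- As `k + 1` is not dominant, it must be the predecessor of a double sign change, which can
    -- only be `l`.
    have hk1 : k + 1 ∈ signChangeSteps F := by
      rw [hS]
      exact mem_dominantSteps.2 ⟨k, h.2.1, l, h.2.2.1, by omega, by omega⟩
    rcases (hmem _).1 hk1 with h2 | ⟨m, ⟨h2, h3⟩, hm⟩
    · exact absurd (hdom _ h2) (h.2.2.2 _ (by omega) (by omega))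
    · obtain rfl : m = l := by
        by_contra hml
        exact h.2.2.2 m (by omega) (by omega) (hdom m (Or.inl h2))
      exact Or.inr ⟨by omega, eq_neg_comm.1 (h.mem_signChanges_iff.1 h2)⟩
  · intro h
    refine congrArg _ (Finset.Subset.antisymm (signChangeSteps_subset hF) fun x hx => ?_)
    obtain ⟨k, l, hkl, hkx, hxl⟩ := exists_dominantSuccessive hx
    rw [hmem]
    rcases h k l hkl with h1 | ⟨h1, h2⟩
    -- Adjacent dominant coefficients are opposite or equal: the first is a sign change of `F`, the
    -- second one of F(⊖Y).
    · obtain rfl : x = l := by omega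
      left
      rw [hkl.mem_signChanges_iff, hkl.mem_signChanges_rescale_iff, h1, pow_one, mul_neg, mul_one,
        neg_neg]
      exact (eq_or_eq_neg_of_abs_eq (hF k) (hF x)
        (abs_eq_of_mem_dominant hkl.2.1 hkl.2.2.1)).symm
    · have hA : l ∈ signChanges F := hkl.mem_signChanges_iff.2 (eq_neg_comm.1 h2)
      have hB : l ∈ signChanges (rescale (neg 1) F) := by
        rw [hkl.mem_signChanges_rescale_iff, h1, pow_two, neg_one_mul_neg_one, mul_one]
        exact eq_neg_comm.1 h2
      rcases hxl.eq_or_lt with rfl | hxl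
      · exact Or.inl (Or.inl hA)
      · exact Or.inr ⟨l, ⟨hA, hB⟩, by omega⟩

end Smax

/-! ### Families with prescribed multiplicities -/

open Classical in
/-- A family of `n` elements in which each `a ∈ S` occurs `f a` times exists if and only if these
multiplicities sum up to `n`. -/
theorem exists_fin_family_iff {α : Type*} (S : Set α) (f : α → ℕ) (R : Finset α)
    (hRS : ∀ a ∈ R, a ∈ S) (hR : ∀ a ∈ S, f a ≠ 0 → a ∈ R) (n : ℕ) :
    (∃ r : Fin n → α, (∀ i, r i ∈ S) ∧
      ∀ a ∈ S, (Finset.univ.filter fun i => r i = a).card = f a) ↔ ∑ a ∈ R, f a = n := by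
  constructor
  · rintro ⟨r, hr, hcount⟩
    -- Every member of the family occurs, so its multiplicity is non-zero; counting by fibres over
    -- `R` gives the sum.
    have h : ∀ i ∈ Finset.univ, r i ∈ R := fun i _ => by
      refine hR _ (hr i) ?_
      rw [← hcount _ (hr i)]
      exact Finset.card_ne_zero_of_mem (Finset.mem_filter.2 ⟨Finset.mem_univ i, rfl⟩)
    have hcard := Finset.card_eq_sum_card_fiberwise h
    rw [Finset.card_univ, Fintype.card_fin] at hcard
    rw [hcard]
    refine Finset.sum_congr rfl fun a ha => ?_
    rw [← hcount a (hRS a ha)]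
  · intro hsum
    let m : Multiset α := ∑ a ∈ R, Multiset.replicate (f a) a
    have hm : m.toList.length = n := by simp [m, hsum]
    have hcount : ∀ a, m.count a = if a ∈ R then f a else 0 := fun a => by
      simp [m, Multiset.count_sum', Multiset.count_replicate]
    let r : List.Vector α n := ⟨m.toList, hm⟩
    refine ⟨r.get, fun i => ?_, fun a ha => ?_⟩
    · have : r.get i ∈ m := by
        rw [← Multiset.mem_toList]
        exact List.Vector.get_mem i r
      obtain ⟨a, ha, h⟩ := Multiset.mem_sum.1 this
      rw [Multiset.eq_of_mem_replicate h]
      exact hRS a ha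
    · have h1 := Fin.card_filter_univ_eq_vector_get_eq_count a r
      have h2 : r.toList.count a = m.count a := by
        rw [← Multiset.coe_count]
        exact congrArg _ (Multiset.coe_toList m)
      rw [h2, hcount] at h1
      refine Eq.trans ?_ (h1.trans ?_)
      · congr! 2
      · split_ifs with h
        · rfl
        · by_contra h0
          exact h (hR a ha (Ne.symm h0))

/-! ### Polynomials with the maximal number of roots -/

namespace Smax

open Polynomial

variable {Γ : Type*} [AddCommGroup Γ] [LinearOrder Γ] [IsOrderedAddMonoid Γ]
variable {P : (Smax Γ)[X]} {c : Tmax Γ}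

/-! ### Saturation polynomials as dominant parts -/

theorem abs_coeff_rescale_ofTmax (P : (Smax Γ)[X]) (c : Tmax Γ) (k : ℕ) :
    abs ((rescale (ofTmax c) P).coeff k) = abs (P.coeff k) * c ^ k := by
  rw [coeff_rescale, map_mul, map_pow, abs_ofTmax]

theorem abs_eval_eq {l : ℕ} (hc : c ≠ 0) (hl : l ∈ dominant (rescale (ofTmax c) P)) :
    abs (P.eval (ofTmax c)) = abs ((rescale (ofTmax c) P).coeff l) := by
  obtain ⟨h0, hmax⟩ := mem_dominant.1 hl
  rw [eval_eq_sum, Polynomial.sum, map_sum]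
  simp only [← coeff_rescale]
  refine le_antisymm (Tmax.sum_le _ _ fun i _ => hmax i) ?_
  refine Tmax.le_sum _ (fun i => abs ((rescale (ofTmax c) P).coeff i)) ?_
  rwa [mem_support_iff, Ne, ← coeff_rescale_eq_zero (ofTmax_ne_zero hc)]

theorem eval_absPoly (P : (Smax Γ)[X]) (c : Tmax Γ) :
    (absPoly P).eval c = abs (P.eval (ofTmax c)) := by
  rw [absPoly, eval_map]
  conv_lhs => rw [← abs_ofTmax c]
  exact eval₂_at_apply abs (ofTmax c)

/-- No cancellation occurs in absolute value: |P(c)| is the maximal modulus of a coefficient of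
P(cY), even when P(c) is balanced. -/
theorem sat_eq_dominant (hP0 : P ≠ 0) (hc : c ≠ 0) :
    sat (ofTmax c) P = dominant (rescale (ofTmax c) P) := by
  have ha := ofTmax_ne_zero hc
  have hF0 : rescale (ofTmax c) P ≠ 0 := fun h => hP0 (Polynomial.ext fun k =>
    (coeff_rescale_eq_zero ha).1 (by rw [h, coeff_zero]))
  obtain ⟨l, hl⟩ := dominant_nonempty hF0
  ext i
  simp only [sat, Finset.mem_filter, Finset.mem_range, abs_eval_eq hc hl, abs_ofTmax,
    ← abs_coeff_rescale_ofTmax]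
  refine ⟨fun h => mem_dominant_of_abs_eq hl h.2.symm, fun h => ⟨Nat.lt_succ_of_le
    (le_natDegree_of_ne_zero ?_), abs_eq_of_mem_dominant hl h⟩⟩
  rw [Ne, ← coeff_rescale_eq_zero ha]
  exact (mem_dominant.1 h).1

open Classical in
theorem coeff_satPoly (hP0 : P ≠ 0) (hc : c ≠ 0) (k : ℕ) :
    (satPoly P (ofTmax c)).coeff k = if k ∈ dominant (rescale (ofTmax c) P) then
      ofTmax (abs (P.eval (ofTmax c)))⁻¹ * (rescale (ofTmax c) P).coeff k else 0 := by
  rw [satPoly, finsetSum_coeff, sat_eq_dominant hP0 hc]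
  simp only [coeff_monomial, Finset.sum_ite_eq', coeff_rescale]
  split_ifs
  · ring
  · rfl

theorem scale_ne_zero (hc : c ≠ 0) {l : ℕ} (hl : l ∈ dominant (rescale (ofTmax c) P)) :
    ofTmax (abs (P.eval (ofTmax c)))⁻¹ ≠ 0 := by
  refine ofTmax_ne_zero (inv_ne_zero ?_)
  rw [abs_eval_eq hc hl, Ne, abs_eq_zero]
  exact (mem_dominant.1 hl).1

theorem coeff_satPoly_ne_zero_iff (hP0 : P ≠ 0) (hc : c ≠ 0) (k : ℕ) :
    (satPoly P (ofTmax c)).coeff k ≠ 0 ↔ k ∈ dominant (rescale (ofTmax c) P) := by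
  rw [coeff_satPoly hP0 hc]
  split_ifs with h
  · exact iff_of_true (mul_ne_zero' (scale_ne_zero hc h) (mem_dominant.1 h).1) h
  · exact iff_of_false (fun h' => h' rfl) h

theorem successiveDegrees_satPoly_iff (hP0 : P ≠ 0) (hc : c ≠ 0) (k l : ℕ) :
    SuccessiveDegrees (satPoly P (ofTmax c)) k l ↔
      DominantSuccessive (rescale (ofTmax c) P) k l := by
  simp only [SuccessiveDegrees, DominantSuccessive, coeff_satPoly_ne_zero_iff hP0 hc]
  refine and_congr_right fun _ => and_congr_right fun _ => and_congr_right fun _ =>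
    forall₃_congr fun i _ _ => ?_
  rw [← coeff_satPoly_ne_zero_iff hP0 hc, not_ne_iff]

theorem coeff_satPoly_eq_neg_iff (hP0 : P ≠ 0) (hc : c ≠ 0) {k l : ℕ}
    (hk : k ∈ dominant (rescale (ofTmax c) P)) (hl : l ∈ dominant (rescale (ofTmax c) P)) :
    (satPoly P (ofTmax c)).coeff l = neg ((satPoly P (ofTmax c)).coeff k) ↔
      (rescale (ofTmax c) P).coeff l = neg ((rescale (ofTmax c) P).coeff k) := by
  rw [coeff_satPoly hP0 hc, coeff_satPoly hP0 hc, if_pos hk, if_pos hl, ← mul_neg,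
    mul_left_inj_signed (ofTmax_mem_signed _) (scale_ne_zero hc hk)]

theorem mul_ofTmax_mem_nonpos {x : Smax Γ} {d : Tmax Γ} (hd : d ≠ 0) :
    x * ofTmax d ∈ nonpos Γ ↔ x ∈ nonpos Γ := by
  have key : ∀ {y : Smax Γ} (e : Tmax Γ), y ∈ nonpos Γ → y * ofTmax e ∈ nonpos Γ := by
    rintro _ e ⟨b, rfl⟩
    exact ⟨b * e, by simp [ofTmax, mk_mul_mk]⟩
  refine ⟨fun h => ?_, key d⟩
  have := key d⁻¹ h
  rwa [mul_assoc, ← ofTmax_mul, mul_inv_cancel₀ hd, ofTmax_one, mul_one] at this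

theorem mk_mem_nonpos_iff {d : Tmax Γ} : mk d 0 ∈ nonpos Γ ↔ d = 0 := by
  refine ⟨fun ⟨e, he⟩ => ?_, fun h => ⟨0, by rw [h]⟩⟩
  rw [mk_eq_mk] at he
  have := zero_le (a := d)
  have := zero_le (a := e)
  grind

/-- Equal moduli leave `y = x`, with a positive square as product, or `y = neg x`, with a negative
product. The case `x = 0` must be excluded because zero lies in `nonpos Γ`. -/
theorem eq_neg_iff_mul_mem_nonpos {x y : Smax Γ} (hx : x ∈ signed Γ) (hy : y ∈ signed Γ)
    (hx0 : x ≠ 0) (h : abs x = abs y) : x = neg y ↔ x * y ∈ nonpos Γ := by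
  have key : ∀ {z : Smax Γ}, z ∈ signed Γ → z ≠ 0 → z * z ∉ nonpos Γ := by
    intro z hz hz0
    have h0 : abs z ≠ 0 := by simpa using hz0
    obtain ⟨d, rfl | rfl⟩ := signed_cases hz <;>
      simpa [mk_mul_mk, mk_mem_nonpos_iff, abs_mk] using h0
  have hneg : x * neg x ∈ nonpos Γ := by
    obtain ⟨d, rfl | rfl⟩ := signed_cases hx <;> exact ⟨d * d, by simp [neg_mk, mk_mul_mk]⟩
  rcases eq_or_eq_neg_of_abs_eq hx hy h with rfl | h'
  · exact iff_of_false (ne_neg_self hx hx0) (key hx hx0)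
  · refine iff_of_true h' ?_
    rw [eq_neg_comm.1 h']
    exact hneg

theorem coeff_satPoly_eq_neg_iff_mul_mem_nonpos (hP : IsSignedPoly P) (hP0 : P ≠ 0) (hc : c ≠ 0)
    {k l : ℕ} (h : SuccessiveDegrees (satPoly P (ofTmax c)) k l) :
    (satPoly P (ofTmax c)).coeff l = neg ((satPoly P (ofTmax c)).coeff k) ↔
      P.coeff l * P.coeff k ∈ nonpos Γ := by
  obtain ⟨-, hk, hl, -⟩ := (successiveDegrees_satPoly_iff hP0 hc k l).1 h
  have hF := isSignedPoly_rescale (ofTmax_mem_signed c) hP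
  rw [coeff_satPoly_eq_neg_iff hP0 hc hk hl, eq_neg_iff_mul_mem_nonpos (hF l) (hF k)
    (mem_dominant.1 hl).1 (abs_eq_of_mem_dominant hl hk), coeff_rescale, coeff_rescale]
  have : P.coeff l * ofTmax c ^ l * (P.coeff k * ofTmax c ^ k) =
      P.coeff l * P.coeff k * ofTmax (c ^ (l + k)) := by
    have hpow : ∀ m, ofTmax (c ^ m) = ofTmax c ^ m := fun m => by
      induction m with
      | zero => rw [pow_zero, pow_zero, ofTmax_one]
      | succ m ih => rw [pow_succ, ofTmax_mul, ih, pow_succ]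
    rw [hpow]
    ring
  rw [this, mul_ofTmax_mem_nonpos (pow_ne_zero _ hc)]

/-! ### Corners and the partition of degrees -/

theorem isCorner_absPoly_of_dominant (hc : c ≠ 0) {i j : ℕ} (hij : i ≠ j)
    (hi : i ∈ dominant (rescale (ofTmax c) P)) (hj : j ∈ dominant (rescale (ofTmax c) P)) :
    Tmax.IsCorner (absPoly P) c := by
  have key : ∀ i ∈ dominant (rescale (ofTmax c) P), i ∈ (absPoly P).support ∧
      (absPoly P).coeff i * c ^ i = (absPoly P).eval c := by
    intro i hi
    rw [eval_absPoly, abs_eval_eq hc hi, abs_coeff_rescale_ofTmax, mem_support_iff, absPoly,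
      coeff_map, Ne, abs_eq_zero, ← coeff_rescale_eq_zero (ofTmax_ne_zero hc)]
    exact ⟨(mem_dominant.1 hi).1, rfl⟩
  exact Or.inl ⟨hc, i, (key i hi).1, j, (key j hj).1, hij, (key i hi).2, (key j hj).2⟩

theorem mem_dominant_rescale_iff (hc : c ≠ 0) {l : ℕ} : l ∈ dominant (rescale (ofTmax c) P) ↔
    P.coeff l ≠ 0 ∧ ∀ i, abs (P.coeff i) * c ^ i ≤ abs (P.coeff l) * c ^ l := by
  simp only [mem_dominant, abs_coeff_rescale_ofTmax, Ne,
    coeff_rescale_eq_zero (ofTmax_ne_zero hc)]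

/-- A degree at least `l` dominates at `c` and one below `l` dominates at `c'`. Higher monomials
gain with the argument, so `c' ≤ c`; exchanging the roles gives equality. -/
theorem slope_unique {c' : Tmax Γ} (hc : c ≠ 0) (hc' : c' ≠ 0) {l : ℕ}
    (h : l ∈ dominantSteps (rescale (ofTmax c) P))
    (h' : l ∈ dominantSteps (rescale (ofTmax c') P)) : c' ≤ c := by
  obtain ⟨-, -, j, hj, -, hlj⟩ := mem_dominantSteps.1 h
  obtain ⟨i, hi, -, -, hil, -⟩ := mem_dominantSteps.1 h'
  rw [mem_dominant_rescale_iff hc] at hj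
  rw [mem_dominant_rescale_iff hc'] at hi
  exact Tmax.le_of_monomial_le hc hc' (by simpa using hj.1) (hil.trans_le hlj) (hj.2 i) (hi.2 j)

/-- The non-zero corners partition the degrees between the order and the degree of `P`. -/
theorem exists_corners (hdiv : ∀ m : ℕ, 0 < m → ∀ a : Γ, ∃ b : Γ, m • b = a) (hP0 : P ≠ 0) :
    ∃ C : Finset (Tmax Γ), (∀ c ∈ C, c ≠ 0) ∧
      (∀ c ≠ 0, (dominantSteps (rescale (ofTmax c) P)).Nonempty → c ∈ C) ∧
      ∑ c ∈ C, (dominantSteps (rescale (ofTmax c) P)).card + P.natTrailingDegree =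
        P.natDegree := by
  classical
  -- A corner is attached to every degree above the order; the value 1 elsewhere is arbitrary.
  have hex : ∀ l, ∃ c : Tmax Γ, c ≠ 0 ∧ (l ∈ Finset.Ioc P.natTrailingDegree P.natDegree →
      l ∈ dominantSteps (rescale (ofTmax c) P)) := by
    intro l
    by_cases hl : l ∈ Finset.Ioc P.natTrailingDegree P.natDegree
    · rw [Finset.mem_Ioc] at hl
      obtain ⟨c, hc, i, j, hil, hlj, hi, hj, hi', hj'⟩ := Tmax.exists_slope hdiv
        (fun i => abs (P.coeff i)) (v := P.natTrailingDegree) (n := P.natDegree) (l := l)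
        (by simpa using fun h => hP0 (trailingCoeff_eq_zero.1 h)) (by simpa using hP0)
        hl.1 hl.2 (fun k hk => by simp [coeff_eq_zero_of_natDegree_lt hk])
      refine ⟨c, hc, fun _ => mem_dominantSteps.2 ⟨i, ?_, j, ?_, hil, hlj⟩⟩
      · exact (mem_dominant_rescale_iff hc).2 ⟨by simpa using hi, hi'⟩
      · exact (mem_dominant_rescale_iff hc).2 ⟨by simpa using hj, hj'⟩
    · exact ⟨1, one_ne_zero, fun h => absurd h hl⟩
  choose s hs0 hs using hex
  have hsub : ∀ c ≠ 0, ∀ l ∈ dominantSteps (rescale (ofTmax c) P),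
      l ∈ Finset.Ioc P.natTrailingDegree P.natDegree := by
    intro c hc l hl
    obtain ⟨i, hi, j, hj, hil, hlj⟩ := mem_dominantSteps.1 hl
    rw [mem_dominant_rescale_iff hc] at hi hj
    exact Finset.mem_Ioc.2 ⟨(natTrailingDegree_le_of_ne_zero hi.1).trans_lt hil,
      hlj.trans (le_natDegree_of_ne_zero hj.1)⟩
  have hiff : ∀ c ≠ 0, ∀ l ∈ dominantSteps (rescale (ofTmax c) P), s l = c := fun c hc l hl =>
    have h := hs l (hsub c hc l hl)
    le_antisymm (slope_unique hc (hs0 l) hl h) (slope_unique (hs0 l) hc h hl)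
  refine ⟨(Finset.Ioc P.natTrailingDegree P.natDegree).image s, ?_, ?_, ?_⟩
  · intro c hc
    obtain ⟨l, -, rfl⟩ := Finset.mem_image.1 hc
    exact hs0 l
  · rintro c hc ⟨l, hl⟩
    exact Finset.mem_image.2 ⟨l, hsub c hc l hl, hiff c hc l hl⟩
  -- The fibre of `s` over `c` is the set of dominant steps at `c`, so the widths add up to the
  -- length of the interval.
  · have hcard := Finset.card_eq_sum_card_image s
      (Finset.Ioc P.natTrailingDegree P.natDegree)
    have hle := natTrailingDegree_le_natDegree P
    rw [Nat.card_Ioc] at hcard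
    suffices h : ∑ c ∈ (Finset.Ioc P.natTrailingDegree P.natDegree).image s,
        (dominantSteps (rescale (ofTmax c) P)).card = P.natDegree - P.natTrailingDegree by
      omega
    rw [hcard]
    refine Finset.sum_congr rfl fun c hc => congrArg _ ?_
    ext l
    rw [Finset.mem_filter]
    obtain ⟨l', -, hl'⟩ := Finset.mem_image.1 hc
    have hc0 : c ≠ 0 := hl' ▸ hs0 l'
    exact ⟨fun h => ⟨hsub c hc0 l h, hiff c hc0 l h⟩, fun h => h.2 ▸ hs l h.1⟩

/-! ### Summing the multiplicities -/

theorem rescale_neg_ofTmax (P : (Smax Γ)[X]) (c : Tmax Γ) :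
    rescale (neg (ofTmax c)) P = rescale (neg 1) (rescale (ofTmax c) P) := by
  ext k
  simp only [coeff_rescale]
  rw [neg_eq_mul, mul_pow]
  ring

theorem ofTmax_injective : Function.Injective (ofTmax (Γ := Γ)) := fun c d h => by
  rw [← abs_ofTmax c, h, abs_ofTmax]

theorem ofTmax_ne_neg_ofTmax {d : Tmax Γ} (hc : c ≠ 0) : ofTmax c ≠ neg (ofTmax d) := by
  intro h
  have hcd := congrArg abs h
  rw [abs_neg, abs_ofTmax, abs_ofTmax] at hcd
  exact ne_neg_self (ofTmax_mem_signed c) (ofTmax_ne_zero hc) (hcd ▸ h)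

/-- `P` has as many roots as its degree if and only if at each corner the numbers of positive and
negative sign changes sum up to the width of the saturation set. -/
theorem hasRootsWithMult_iff (hP : IsSignedPoly P) (hP0 : P ≠ 0) (C : Finset (Tmax Γ))
    (hC0 : ∀ c ∈ C, c ≠ 0)
    (hC : ∀ c ≠ 0, (dominantSteps (rescale (ofTmax c) P)).Nonempty → c ∈ C)
    (hsum : ∑ c ∈ C, (dominantSteps (rescale (ofTmax c) P)).card + P.natTrailingDegree =
      P.natDegree) :
    HasRootsWithMult P P.natDegree ↔ ∀ c ∈ C, (signChanges (rescale (ofTmax c) P)).card +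
      (signChanges (rescale (neg 1) (rescale (ofTmax c) P))).card =
        (dominantSteps (rescale (ofTmax c) P)).card := by
  classical
  let f : Smax Γ → ℕ := fun a =>
    if a = 0 then P.natTrailingDegree else (signChanges (rescale a P)).card
  have hf : ∀ a ∈ signed Γ, mult a P = f a := by
    intro a ha
    by_cases h0 : a = 0
    · simp only [f, h0, if_true, mult_zero_eq hP hP0]
    · simp only [f, h0, if_false, mult_eq_card_signChanges ha h0 hP hP0]
  have hfC : ∀ c ∈ C, f (ofTmax c) = (signChanges (rescale (ofTmax c) P)).card ∧
      f (neg (ofTmax c)) = (signChanges (rescale (neg 1) (rescale (ofTmax c) P))).card := by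
    intro c hc
    have h0 := ofTmax_ne_zero (hC0 c hc)
    simp only [f, neg_eq_zero, h0, if_false, rescale_neg_ofTmax, and_self]
  -- Only zero and the two signed versions of the elements of `C` can be roots.
  let R : Finset (Smax Γ) := insert 0 (C.image ofTmax ∪ C.image fun c => neg (ofTmax c))
  have hRS : ∀ a ∈ R, a ∈ signed Γ := by
    intro a ha
    simp only [R, Finset.mem_insert, Finset.mem_union, Finset.mem_image] at ha
    rcases ha with rfl | ⟨c, -, rfl⟩ | ⟨c, -, rfl⟩
    exacts [zero_mem_signed, ofTmax_mem_signed c, neg_mem_signed (ofTmax_mem_signed c)]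
  have hR : ∀ a ∈ signed Γ, f a ≠ 0 → a ∈ R := by
    intro a ha hfa
    simp only [R, Finset.mem_insert, Finset.mem_union, Finset.mem_image]
    by_cases h0 : a = 0
    · exact Or.inl h0
    right
    simp only [f, h0, if_false, Finset.card_ne_zero] at hfa
    obtain ⟨c, rfl | rfl⟩ := signed_cases ha
    · have hc : c ≠ 0 := by rintro rfl; exact h0 rfl
      exact Or.inl ⟨c, hC c hc (hfa.mono signChanges_subset_dominantSteps), rfl⟩
    · have hc : c ≠ 0 := by rintro rfl; exact h0 rfl
      refine Or.inr ⟨c, hC c hc ?_, rfl⟩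
      rw [← dominantSteps_rescale_neg_one, ← rescale_neg_ofTmax]
      exact hfa.mono signChanges_subset_dominantSteps
  have hRsum : ∑ a ∈ R, f a = ∑ c ∈ C, ((signChanges (rescale (ofTmax c) P)).card +
      (signChanges (rescale (neg 1) (rescale (ofTmax c) P))).card) + P.natTrailingDegree := by
    rw [Finset.sum_insert, Finset.sum_union, Finset.sum_image, Finset.sum_image,
      Finset.sum_add_distrib, Finset.sum_congr rfl fun c hc => (hfC c hc).1,
      Finset.sum_congr rfl fun c hc => (hfC c hc).2, add_comm]
    · simp [f]
    · exact fun c _ d _ h => ofTmax_injective (neg_inj.1 h)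
    · exact fun c _ d _ h => ofTmax_injective h
    · rw [Finset.disjoint_left]
      intro a ha ha'
      obtain ⟨c, hc, rfl⟩ := Finset.mem_image.1 ha
      obtain ⟨d, -, hd⟩ := Finset.mem_image.1 ha'
      exact ofTmax_ne_neg_ofTmax (hC0 c hc) hd.symm
    · simp only [Finset.mem_union, Finset.mem_image]
      rintro (⟨c, hc, h⟩ | ⟨c, hc, h⟩)
      · exact ofTmax_ne_zero (hC0 c hc) h
      · exact ofTmax_ne_zero (hC0 c hc) (neg_eq_zero.1 h)
  have hroots : HasRootsWithMult P P.natDegree ↔ ∑ a ∈ R, f a = P.natDegree := by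
    rw [← exists_fin_family_iff (signed Γ) f R hRS hR]
    refine exists_congr fun r => and_congr_right fun _ => forall₂_congr fun a ha => ?_
    rw [hf a ha, Nat.cast_inj]
    convert Iff.rfl
  rw [hroots, hRsum, ← hsum, Nat.add_right_cancel_iff]
  -- Each term is at most the corresponding width, so the sums agree iff all terms do.
  exact Finset.sum_eq_sum_iff_of_le fun c _ =>
    card_add_card_signChanges_le (isSignedPoly_rescale (ofTmax_mem_signed c) hP)

end Smax

end

theorem mainTheorem9 {Γ : Type*} [AddCommGroup Γ] [LinearOrder Γ] [IsOrderedAddMonoid Γ]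
    (hdiv : ∀ m : ℕ, 0 < m → ∀ a : Γ, ∃ b : Γ, m • b = a)
    (n : ℕ) (P : Polynomial (Smax Γ)) (hP : Smax.IsSignedPoly P) (hn : P.degree = n) :
    (Smax.HasRootsWithMult P n ↔
      ∀ c : Tmax Γ, c ≠ 0 → Tmax.IsCorner (Smax.absPoly P) c →
        ∀ k l : ℕ, SuccessiveDegrees (Smax.satPoly P (Smax.ofTmax c)) k l →
          l - k = 1 ∨ (l - k = 2 ∧
            (Smax.satPoly P (Smax.ofTmax c)).coeff l =
              Smax.neg ((Smax.satPoly P (Smax.ofTmax c)).coeff k))) ∧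
    (∀ c : Tmax Γ, c ≠ 0 → Tmax.IsCorner (Smax.absPoly P) c →
      ∀ k l : ℕ, SuccessiveDegrees (Smax.satPoly P (Smax.ofTmax c)) k l →
        ((Smax.satPoly P (Smax.ofTmax c)).coeff l =
            Smax.neg ((Smax.satPoly P (Smax.ofTmax c)).coeff k) ↔
          P.coeff l * P.coeff k ∈ Smax.nonpos Γ)) := by
  have hP0 : P ≠ 0 := by
    rintro rfl
    simp at hn
  obtain rfl : n = P.natDegree := (Polynomial.natDegree_eq_of_degree_eq_some hn).symm
  refine ⟨?_, fun c hc _ k l h =>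
    Smax.coeff_satPoly_eq_neg_iff_mul_mem_nonpos hP hP0 hc h⟩
  obtain ⟨C, hC0, hC, hsum⟩ := Smax.exists_corners hdiv hP0
  rw [Smax.hasRootsWithMult_iff hP hP0 C hC0 hC hsum]
  have hiff := fun c : Tmax Γ => Smax.card_add_card_signChanges_eq_iff
    (Smax.isSignedPoly_rescale (Smax.ofTmax_mem_signed c) hP)
  simp only [hiff]
  constructor
  · intro h c hc _ k l hkl
    rw [Smax.successiveDegrees_satPoly_iff hP0 hc] at hkl
    rw [Smax.coeff_satPoly_eq_neg_iff hP0 hc hkl.2.1 hkl.2.2.1]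
    exact h c (hC c hc ⟨l, hkl.right_mem_dominantSteps⟩) k l hkl
  · intro h c hcC k l hkl
    have hc := hC0 c hcC
    rw [← Smax.coeff_satPoly_eq_neg_iff hP0 hc hkl.2.1 hkl.2.2.1]
    -- The two dominant degrees `k` and `l` themselves exhibit `c` as a corner.
    exact h c hc (Smax.isCorner_absPoly_of_dominant hc hkl.1.ne hkl.2.1 hkl.2.2.1) k l
      ((Smax.successiveDegrees_satPoly_iff hP0 hc k l).2 hkl)
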